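/- For integers $m\ge 1$ and $n\ge 3$, let $mK_n$ be the graph on vertices $v_1,\dots,v_n$ with exactly $m$ edges between any two distinct vertices and no loops. An arithmetical structure on $mK_n$ is a pair $(\mathbf r,\mathbf d)$ of vectors of $n$ positive integers such that $\gcd(r_1,\dots,r_n)=1$ and $r_i d_i=\sum_{j\ne i} m\,r_j$ for every $i$. Let $A_{\mathrm{dec}}(mK_n)$ be the set of arithmetical structures on $mK_n$ with $r_1\ge r_2\ge\cdots\ge r_n$. This set is finite, and for every $\epsilon>0$ there is a constant $C_\epsilon$, depending only on $\epsilon$ (in particular not on $m$ or $n$), such that for all $m\ge 1$ $$\#A_{\mathrm{dec}}(mK_3)\le C_\epsilon\, m^{\frac35+\epsilon},\qquad \#A_{\mathrm{dec}}(mK_4)\le C_\epsilon\, m^{\frac{28}{17}+\epsilon},$$ and for all $n\ge 5$ and $m\ge 1$ $$\#A_{\mathrm{dec}}(mK_n)\le C_\epsilon\,(nm)^{\epsilon}\left(n^{4/3}m^2\right)^{\frac{28}{17}\cdot 2^{\,n-5}}.$$ -/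

import Mathlib

/-- A loopless undirected multigraph on the vertices `0, …, n - 1`, given by the number
`edges i j` of edges between each pair of vertices. -/
structure LooplessMultigraph (n : ℕ) where
  edges : Fin n → Fin n → ℕ
  symm : ∀ i j, edges i j = edges j i
  loopless : ∀ i, edges i i = 0

namespace LooplessMultigraph

/-- `m K_n`: the graph on `n` vertices with `m` edges between any two distinct vertices. -/
def multiComplete (m n : ℕ) : LooplessMultigraph n where
  edges i j := if i = j then 0 else m
  symm i j := by simp only [eq_comm]
  loopless i := by simp

/-- The set `A(G)` of arithmetical structures on `G`: pairs `(r, d)` of vectors of positive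
integers with `gcd(r) = 1` and `r_i d_i = ∑_{j ≠ i} r_j δ_{ij}` for every `i`. -/
def arithmeticalStructures {n : ℕ} (G : LooplessMultigraph n) :
    Set ((Fin n → ℕ) × (Fin n → ℕ)) :=
  {p | (∀ i, 0 < p.1 i) ∧ (∀ i, 0 < p.2 i) ∧ Finset.univ.gcd p.1 = 1 ∧
    ∀ i, p.1 i * p.2 i = ∑ j ∈ Finset.univ.erase i, p.1 j * G.edges i j}

/-- The set `A_dec(G)` of arithmetical structures `(r, d)` on `G` with `r_1 ≥ r_2 ≥ ⋯ ≥ r_n`. -/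
def decArithmeticalStructures {n : ℕ} (G : LooplessMultigraph n) :
    Set ((Fin n → ℕ) × (Fin n → ℕ)) :=
  {p ∈ G.arithmeticalStructures | Antitone p.1}

end LooplessMultigraph

/-! Completing the row sum gives `r_i (d_i + m) = m ∑ r_j`, so the numbers `x_i = d_i + m` satisfy
`∑ 1 / x_i = 1 / m`. They increase when `r` decreases, and they determine `d` and, because `gcd(r) =
1`, also `r`. It is therefore enough to count increasing solutions of `1 / x_1 + ⋯ + 1 / x_k = a /
n`. Allowing a general numerator `a` makes induction on `k` possible.

Three fractions carry the arithmetic. After the factors `gcd(x_i, n)` are split off, at the cost of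
a few divisor functions, a solution is encoded by relative gcds `(α, β, γ, δ)` with `N₁ γ + N₂ β +
N₃ α = a α β γ δ`. A size argument (`IsGcdQuadruple.small_cases`) shows that one of four quantities
built from the quadruple is at most `T`, where `T` is of order `(n / a) ^ (3 / 5)`. Once that
quantity is fixed, the remaining unknowns are found among divisors of known numbers
(`card_gcdQuadruples_le`), so the divisor bound yields `n ^ ε (n / a) ^ (3 / 5)`.

For more fractions, the smallest denominator `x` is removed. It leaves the fraction `b / (n x)` with
`b = a x - n`, where `x` is at most `k n / a`, and the previous bound is summed over `x`. Distinct
`x` give distinct `b` in one class modulo `a`, so the sums of negative powers of `b` are small. Four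
and five fractions are treated this way explicitly. From then on each step squares `n ^ 2 / a` up to
constants, which doubles the exponent (`ncard_unitFractionSolutions_succ_le_rpow`). The weight `k ^
(4 / 3)` keeps the constant independent of `k`: for large `k` the factor lost at each step is at
most one (`doubling_constant_le_one`). -/

/-! ### Divisor bound, power sums and a counting principle -/

/-- The divisor bound: the number of divisors of `n` is `O_ε(n ^ ε)`. -/
theorem Nat.exists_card_divisors_le_rpow (ε : ℝ) (hε : 0 < ε) :
    ∃ C : ℝ, 1 ≤ C ∧ ∀ n : ℕ, n ≠ 0 → (n.divisors.card : ℝ) ≤ C * (n : ℝ) ^ ε := by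
  have hlog : 0 < Real.log 2 := Real.log_pos (by norm_num)
  -- Primes `p ≥ P` have `p ^ ε ≥ 2`, so `e + 1 ≤ 2 ^ e ≤ p ^ (ε e)` without loss. Each of the fewer
  -- than `P + 1` smaller primes loses at most the factor `A`.
  obtain ⟨P, hP⟩ := exists_nat_ge ((2 : ℝ) ^ (1 / ε))
  set A : ℝ := 1 + 1 / (ε * Real.log 2) with hA
  have hA1 : 1 ≤ A := by
    rw [hA]; have : 0 < 1 / (ε * Real.log 2) := by positivity
    linarith
  refine ⟨A ^ P, one_le_pow₀ hA1, fun n hn => ?_⟩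
  have key : ∀ p ∈ n.primeFactors, ((n.factorization p + 1 : ℕ) : ℝ) ≤
      (if p < P then A else 1) * ((p : ℝ) ^ n.factorization p) ^ ε := by
    intro p hp
    have hp2 : (2 : ℝ) ≤ p := by exact_mod_cast (Nat.prime_of_mem_primeFactors hp).two_le
    set e := n.factorization p
    rw [← Real.rpow_natCast, ← Real.rpow_mul (by positivity), mul_comm (e : ℝ) ε,
      Real.rpow_mul (by positivity), Real.rpow_natCast]
    split_ifs with h
    · have h1 : 1 + e * (ε * Real.log 2) ≤ ((p : ℝ) ^ ε) ^ e := by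
        have h2 : 1 + ε * Real.log 2 ≤ (p : ℝ) ^ ε := by
          calc 1 + ε * Real.log 2 ≤ Real.exp (ε * Real.log 2) := by
                rw [add_comm]; exact Real.add_one_le_exp _
            _ = (2 : ℝ) ^ ε := by rw [Real.rpow_def_of_pos (by norm_num), mul_comm]
            _ ≤ (p : ℝ) ^ ε := Real.rpow_le_rpow (by norm_num) hp2 hε.le
        calc 1 + e * (ε * Real.log 2) ≤ (1 + ε * Real.log 2) ^ e :=
              one_add_mul_le_pow (by have : 0 < ε * Real.log 2 := by positivity
                                     linarith) e
          _ ≤ _ := pow_le_pow_left₀ (by positivity) h2 e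
      calc ((e + 1 : ℕ) : ℝ) ≤ A * (1 + e * (ε * Real.log 2)) := by
            rw [hA]; push_cast
            have : (1 + 1 / (ε * Real.log 2)) * (1 + e * (ε * Real.log 2)) =
                1 + e + e * (ε * Real.log 2) + 1 / (ε * Real.log 2) := by
              field_simp; ring
            rw [this]
            have h3 : 0 ≤ e * (ε * Real.log 2) := by positivity
            have h4 : 0 ≤ 1 / (ε * Real.log 2) := by positivity
            linarith
        _ ≤ _ := mul_le_mul_of_nonneg_left h1 (by linarith)
    · have hpP : (P : ℝ) ≤ p := by exact_mod_cast not_lt.mp h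
      have h2 : (2 : ℝ) ≤ (p : ℝ) ^ ε := by
        calc (2 : ℝ) = ((2 : ℝ) ^ (1 / ε)) ^ ε := by
              rw [← Real.rpow_mul (by norm_num), one_div_mul_cancel hε.ne', Real.rpow_one]
          _ ≤ _ := Real.rpow_le_rpow (by positivity) (hP.trans hpP) hε.le
      rw [one_mul]
      calc ((e + 1 : ℕ) : ℝ) ≤ (2 : ℝ) ^ e := by exact_mod_cast Nat.lt_two_pow_self
        _ ≤ _ := pow_le_pow_left₀ (by norm_num) h2 e
  rw [Nat.card_divisors hn]
  push_cast at key ⊢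
  calc ∏ p ∈ n.primeFactors, ((n.factorization p : ℝ) + 1)
      ≤ ∏ p ∈ n.primeFactors, ((if p < P then A else 1) *
          ((p : ℝ) ^ n.factorization p) ^ ε) :=
        Finset.prod_le_prod (fun _ _ => by positivity) key
    _ = (∏ p ∈ n.primeFactors, (if p < P then A else 1)) *
          (∏ p ∈ n.primeFactors, (p : ℝ) ^ n.factorization p) ^ ε := by
        rw [Finset.prod_mul_distrib, Real.finsetProd_rpow]
        intro i _; positivity
    _ = (∏ p ∈ n.primeFactors, (if p < P then A else 1)) * (n : ℝ) ^ ε := by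
        congr 2
        conv_rhs => rw [← Nat.prod_factorization_pow_eq_self hn]
        rw [Finsupp.prod]; push_cast; rfl
    _ ≤ A ^ P * (n : ℝ) ^ ε := by
        gcongr
        rw [Finset.prod_ite, Finset.prod_const, Finset.prod_const_one, mul_one]
        refine pow_le_pow_right₀ hA1 ?_
        calc _ ≤ (Finset.range P).card := Finset.card_le_card (fun p hp => by
              simpa using (Finset.mem_filter.mp hp).2)
          _ = P := Finset.card_range P

/-- Telescoping bound for the partial sums of `j ^ (-3/5)`. -/
theorem sum_Icc_rpow_neg_three_fifths_le (M : ℕ) :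
    ∑ j ∈ Finset.Icc 1 M, (j : ℝ) ^ (-(3 / 5) : ℝ) ≤ 5 / 2 * (M : ℝ) ^ (2 / 5 : ℝ) := by
  induction M with
  | zero => simp
  | succ M ih =>
    rw [Finset.sum_Icc_succ_top (by omega)]
    set y : ℝ := (M : ℝ) + 1 with hy
    have hy0 : 0 < y := by positivity
    -- Bernoulli's inequality for the concave power `2 / 5`: the increment of `y ^ (2 / 5)` over a
    -- unit step is at least `2 / 5 * y ^ (-3 / 5)`.
    have hM : (M : ℝ) ^ (2 / 5 : ℝ) ≤ y ^ (2 / 5 : ℝ) * (1 - 2 / 5 * (1 / y)) := by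
      have h1 : (M : ℝ) = y * (1 + -(1 / y)) := by field_simp; rw [hy]; ring
      have h0 : -1 ≤ -(1 / y) := by
        have : 1 / y ≤ 1 := by rw [div_le_one hy0, hy]; linarith [Nat.cast_nonneg (α := ℝ) M]
        linarith
      rw [h1, Real.mul_rpow hy0.le (by linarith)]
      refine mul_le_mul_of_nonneg_left ?_ (by positivity)
      have := rpow_one_add_le_one_add_mul_self h0 (p := 2 / 5) (by norm_num) (by norm_num)
      linarith
    have h2 : y ^ (-(3 / 5) : ℝ) = y ^ (2 / 5 : ℝ) * (1 / y) := by
      rw [show (-(3 / 5) : ℝ) = 2 / 5 - 1 by norm_num, Real.rpow_sub_one hy0.ne']; ring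
    push_cast
    rw [h2]
    linarith

/-- For `s > 1` the finite sums of `b ^ (-s)` over natural numbers are uniformly bounded. -/
theorem exists_sum_rpow_neg_le (s : ℝ) (hs : 1 < s) :
    ∃ Z : ℝ, 0 < Z ∧ ∀ B : Finset ℕ, ∑ b ∈ B, (b : ℝ) ^ (-s) ≤ Z := by
  have hsum : Summable fun b : ℕ => (b : ℝ) ^ (-s) := Real.summable_nat_rpow.mpr (by linarith)
  refine ⟨∑' b : ℕ, (b : ℝ) ^ (-s) + 1, ?_, fun B => ?_⟩
  · have : 0 ≤ ∑' b : ℕ, (b : ℝ) ^ (-s) := tsum_nonneg fun b => by positivity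
    linarith
  · have := hsum.sum_le_tsum B (fun b _ => by positivity)
    linarith

/-- If the elements of `S` are determined by a key `p ∈ K`, a datum `u` with at most `D` values
for given `p`, and a datum `v` with at most `D` values for given `p` and `u`, then
`#S ≤ #K * D ^ 2`. -/
theorem Finset.card_le_card_mul_sq_of_keys {σ : Type*} [DecidableEq σ] {S : Finset σ} {D : ℕ}
    (p u v : σ → ℕ)
    (K : Finset ℕ) (Φ : ℕ → Finset ℕ) (Ψ : ℕ → ℕ → Finset ℕ)
    (hp : ∀ s ∈ S, p s ∈ K)
    (hu : ∀ s ∈ S, u s ∈ Φ (p s)) (hΦ : ∀ s ∈ S, (Φ (p s)).card ≤ D)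
    (hv : ∀ s ∈ S, v s ∈ Ψ (p s) (u s)) (hΨ : ∀ s ∈ S, (Ψ (p s) (u s)).card ≤ D)
    (inj : ∀ s ∈ S, ∀ t ∈ S, p s = p t → u s = u t → v s = v t → s = t) :
    S.card ≤ K.card * D ^ 2 := by
  rw [mul_comm]
  refine Finset.card_le_mul_card_image_of_maps_to (f := p) hp _ (fun c _ => ?_)
  -- The bounds on `Φ` and `Ψ` are known only at keys that occur, so empty fibres are set apart.
  obtain h0 | ⟨s₀, hs₀⟩ := (S.filter fun s => p s = c).eq_empty_or_nonempty
  · simp [h0]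
  have hc := (Finset.mem_filter.mp hs₀).2
  calc _ ≤ D * (Φ c).card := by
        refine Finset.card_le_mul_card_image_of_maps_to (f := u) (fun s hs => ?_) _ (fun d _ => ?_)
        · have hs' := Finset.mem_filter.mp hs
          exact hs'.2 ▸ hu s hs'.1
        · obtain h0 | ⟨s₁, hs₁⟩ :=
            ((S.filter fun s => p s = c).filter fun s => u s = d).eq_empty_or_nonempty
          · simp [h0]
          simp only [Finset.mem_filter] at hs₁
          obtain ⟨⟨hs₁, hpc⟩, hud⟩ := hs₁
          calc _ ≤ (Ψ c d).card := by
                refine Finset.card_le_card_of_injOn v (fun s hs => ?_) (fun s hs t ht hst => ?_)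
                · simp only [Finset.coe_filter, Finset.mem_filter, Set.mem_ofPred_eq] at hs
                  obtain ⟨⟨hs, rfl⟩, rfl⟩ := hs
                  exact hv s hs
                · simp only [Finset.coe_filter, Finset.mem_filter, Set.mem_ofPred_eq] at hs ht
                  exact inj s hs.1.1 t ht.1.1 (hs.1.2.trans ht.1.2.symm)
                    (hs.2.trans ht.2.symm) hst
            _ ≤ D := by rw [← hpc, ← hud]; exact hΨ s₁ hs₁
    _ ≤ D * D := Nat.mul_le_mul_left _ (hc ▸ hΦ s₀ (Finset.mem_filter.mp hs₀).1)
    _ = D ^ 2 := (sq D).symm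

/-! ### Relative gcds and the size argument -/

/-- The relative greatest common divisors `(α, β, γ, δ)` of a solution of
`a = N₁ / (α β δ) + N₂ / (α γ δ) + N₃ / (β γ δ)` with decreasing summands. -/
structure IsGcdQuadruple (a N₁ N₂ N₃ : ℕ) (q : ℕ × ℕ × ℕ × ℕ) : Prop where
  pos₁ : 0 < q.1
  pos₂ : 0 < q.2.1
  pos₃ : 0 < q.2.2.1
  pos₄ : 0 < q.2.2.2
  eq : N₁ * q.2.2.1 + N₂ * q.2.1 + N₃ * q.1 = a * (q.1 * q.2.1 * q.2.2.1 * q.2.2.2)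
  le₁₂ : N₂ * q.2.1 ≤ N₁ * q.2.2.1
  le₂₃ : N₃ * q.1 ≤ N₂ * q.2.1
  coprime : Nat.Coprime q.1 N₁

namespace IsGcdQuadruple

variable {a N₁ N₂ N₃ α β γ δ : ℕ}

/-- The first summand is the largest, so the whole sum is at most `3 * N₁ * γ`, and `γ` cancels. -/
theorem mul_le (h : IsGcdQuadruple a N₁ N₂ N₃ (α, β, γ, δ)) : a * (α * β * δ) ≤ 3 * N₁ := by
  have h3 : 0 < γ := h.pos₃
  have h1 := h.eq
  have h2 := h.le₁₂
  have h4 := h.le₂₃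
  simp only at h1 h2 h4
  refine Nat.le_of_mul_le_mul_right (c := γ) ?_ h3
  linarith [show a * (α * β * γ * δ) = a * (α * β * δ) * γ by ring]

/-- The quantity `w` with `a α β δ = N₁ + w`. -/
theorem exists_first (h : IsGcdQuadruple a N₁ N₂ N₃ (α, β, γ, δ)) (hN₂ : 0 < N₂) :
    ∃ w, 0 < w ∧ a * (α * β * δ) = N₁ + w ∧ w * γ = N₂ * β + N₃ * α := by
  have h2 : 0 < β := h.pos₂
  have h3 : 0 < γ := h.pos₃
  have h1 := h.eq
  simp only at h1
  have hpos : 0 < N₂ * β := by positivity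
  have hlt : N₁ < a * (α * β * δ) := by
    refine Nat.lt_of_mul_lt_mul_right (a := γ) ?_
    linarith [show a * (α * β * γ * δ) = a * (α * β * δ) * γ by ring, Nat.zero_le (N₃ * α)]
  obtain ⟨w, hw⟩ := Nat.exists_eq_add_of_lt hlt
  refine ⟨w + 1, by omega, by omega, ?_⟩
  have : a * (α * β * γ * δ) = a * (α * β * δ) * γ := by ring
  rw [this, hw] at h1
  linarith

/-- The quantity `e` with `a β γ δ = N₃ + gcd(N₁, N₂) e`. -/
theorem exists_third (h : IsGcdQuadruple a N₁ N₂ N₃ (α, β, γ, δ)) (hN₁ : 0 < N₁) :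
    ∃ e, 0 < e ∧ a * (β * γ * δ) = N₃ + N₁.gcd N₂ * e ∧
      N₁.gcd N₂ * e * α = N₁ * γ + N₂ * β := by
  have h0 : 0 < α := h.pos₁
  have h3 : 0 < γ := h.pos₃
  have h1 := h.eq
  simp only at h1
  have hpos : 0 < N₁ * γ := by positivity
  have hlt : N₃ < a * (β * γ * δ) := by
    refine Nat.lt_of_mul_lt_mul_right (a := α) ?_
    linarith [show a * (α * β * γ * δ) = a * (β * γ * δ) * α by ring, Nat.zero_le (N₂ * β)]
  obtain ⟨w, hw⟩ := Nat.exists_eq_add_of_lt hlt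
  have hwα : (w + 1) * α = N₁ * γ + N₂ * β := by
    have : a * (α * β * γ * δ) = a * (β * γ * δ) * α := by ring
    rw [this, hw] at h1
    linarith
  -- Coprimality of `α` and `N₁` is used here: it lets `α` be cancelled, so that the excess over
  -- `N₃` runs through multiples of the gcd only.
  have hdvd : N₁.gcd N₂ ∣ w + 1 := by
    have hc : Nat.Coprime (N₁.gcd N₂) α :=
      (Nat.Coprime.coprime_dvd_right (Nat.gcd_dvd_left _ _) h.coprime).symm
    refine hc.dvd_of_dvd_mul_right ?_
    rw [hwα]
    exact dvd_add ((Nat.gcd_dvd_left _ _).mul_right _) ((Nat.gcd_dvd_right _ _).mul_right _)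
  obtain ⟨e, he⟩ := hdvd
  refine ⟨e, Nat.pos_of_ne_zero ?_, by rw [hw, ← he]; ring, by rw [← he, hwα]⟩
  rintro rfl
  simp at he

theorem a_le (h : IsGcdQuadruple a N₁ N₂ N₃ (α, β, γ, δ)) : a ≤ 3 * N₁ := by
  have h1 : 0 < α := h.pos₁
  have h2 : 0 < β := h.pos₂
  have h4 : 0 < δ := h.pos₄
  exact (Nat.le_mul_of_pos_right a (by positivity)).trans h.mul_le

/-- One of four products attached to a quadruple is small. -/
theorem small_cases {N T : ℕ} (h : IsGcdQuadruple a N₁ N₂ N₃ (α, β, γ, δ)) (hN : 0 < N)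
    (hN₁ : N₁ ∣ N) (hN₂ : N₂ ∣ N) (hT : 36 * N ^ 3 ≤ a ^ 3 * T ^ 5) :
    α * β ≤ T ∨ α * δ ≤ T ∨ a * (α * β * δ) ≤ N₁ + a * T ∨
      ∃ e, 0 < e ∧ e ≤ T ∧ a * (β * γ * δ) = N₃ + N₁.gcd N₂ * e := by
  have hN₁0 : 0 < N₁ := Nat.pos_of_dvd_of_pos hN₁ hN
  have hN₂0 : 0 < N₂ := Nat.pos_of_dvd_of_pos hN₂ hN
  obtain ⟨w, hw0, hw, hwγ⟩ := h.exists_first hN₂0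
  obtain ⟨e, he0, he, heα⟩ := h.exists_third hN₁0
  by_contra! hcon
  obtain ⟨c1, c2, c3, c4⟩ := hcon
  have c3' : a * T < w := by omega
  have c4' : T < e := by
    by_contra hle
    exact c4 e he0 (not_lt.mp hle) he
  have hα : 0 < α := h.pos₁
  have hγ : 0 < γ := h.pos₃
  have hg : 0 < N₁.gcd N₂ := Nat.gcd_pos_of_pos_left _ hN₁0
  have h12 := h.le₁₂
  have h23 := h.le₂₃
  simp only at h12 h23
  have hlcm : N₁ * N₂ ≤ N₁.gcd N₂ * N := by
    rw [← Nat.gcd_mul_lcm]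
    exact Nat.mul_le_mul_left _ (Nat.le_of_dvd hN (Nat.lcm_dvd hN₁ hN₂))
  -- By the order of the summands, `w γ ≤ 2 N₂ β` and `gcd(N₁, N₂) e α ≤ 2 N₁ γ`. Their product is
  -- compared with `N₁ N₂ / gcd(N₁, N₂) = lcm(N₁, N₂) ≤ N`.
  have hwe : w * e * α ≤ 4 * N * β := by
    refine Nat.le_of_mul_le_mul_right (c := N₁.gcd N₂ * γ) ?_ (by positivity)
    calc w * e * α * (N₁.gcd N₂ * γ) = (w * γ) * (N₁.gcd N₂ * e * α) := by ring
      _ ≤ (2 * (N₂ * β)) * (2 * (N₁ * γ)) := Nat.mul_le_mul (by omega) (by omega)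
      _ = 4 * β * γ * (N₁ * N₂) := by ring
      _ ≤ 4 * β * γ * (N₁.gcd N₂ * N) := Nat.mul_le_mul_left _ hlcm
      _ = _ := by ring
  have hprod : a * (α * β * δ) ≤ 3 * N :=
    h.mul_le.trans (Nat.mul_le_mul_left _ (Nat.le_of_dvd hN hN₁))
  have hup : a ^ 2 * ((α * β) * (α * δ) ^ 2 * w * e) ≤ 36 * N ^ 3 := by
    calc a ^ 2 * ((α * β) * (α * δ) ^ 2 * w * e)
        = (w * e * α) * (a ^ 2 * α ^ 2 * β * δ ^ 2) := by ring
      _ ≤ (4 * N * β) * (a ^ 2 * α ^ 2 * β * δ ^ 2) := Nat.mul_le_mul_right _ hwe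
      _ = 4 * N * (a * (α * β * δ)) ^ 2 := by ring
      _ ≤ 4 * N * (3 * N) ^ 2 := Nat.mul_le_mul_left _ (Nat.pow_le_pow_left hprod 2)
      _ = 36 * N ^ 3 := by ring
  have ha : 0 < a := by
    rcases Nat.eq_zero_or_pos a with rfl | ha
    · simp only [zero_mul] at hw; omega
    · exact ha
  -- If every alternative fails, the five factors `α β`, `α δ` (twice), `w / a` and `e` all exceed
  -- `T`. This is the origin of the exponent `3 / 5`.
  have hlow : a ^ 3 * T ^ 5 < a ^ 2 * ((α * β) * (α * δ) ^ 2 * w * e) := by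
    calc a ^ 3 * T ^ 5 = a ^ 2 * (T * T ^ 2 * (a * T) * T) := by ring
      _ < a ^ 2 * ((α * β) * (α * δ) ^ 2 * w * e) := by gcongr
  omega

end IsGcdQuadruple

/-! ### Counting quadruples through divisors -/

/-- The quadruples attached to fixed `N₁, N₂, N₃ ∣ N` number at most `4 T D ^ 2`, where `D` bounds
the divisor function up to `50 N ^ 4` and `T` is of order `(N / a) ^ (3 / 5)`. -/
theorem card_gcdQuadruples_le {a N N₁ N₂ N₃ T D : ℕ} (ha : 0 < a) (hN : 0 < N) (hN₁ : N₁ ∣ N)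
    (hN₂ : N₂ ∣ N) (hN₃ : N₃ ∣ N) (hT : 36 * N ^ 3 ≤ a ^ 3 * T ^ 5) (hTN : T ≤ 4 * N)
    (hD : ∀ k, 0 < k → k ≤ 50 * N ^ 4 → k.divisors.card ≤ D)
    (Q : Finset (ℕ × ℕ × ℕ × ℕ)) (hQ : ∀ q ∈ Q, IsGcdQuadruple a N₁ N₂ N₃ q) :
    Q.card ≤ 4 * T * D ^ 2 := by
  classical
  have hN₁0 : 0 < N₁ := Nat.pos_of_dvd_of_pos hN₁ hN
  have hN₂0 : 0 < N₂ := Nat.pos_of_dvd_of_pos hN₂ hN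
  have hN₁N : N₁ ≤ N := Nat.le_of_dvd hN hN₁
  have hN₂N : N₂ ≤ N := Nat.le_of_dvd hN hN₂
  have hN₃N : N₃ ≤ N := Nat.le_of_dvd hN hN₃
  have hpow1 : N ≤ N ^ 4 := Nat.le_self_pow (by norm_num) N
  have hpow2 : N ^ 2 ≤ N ^ 4 := Nat.pow_le_pow_right hN (by norm_num)
  let Q₁ := Q.filter fun q => q.1 * q.2.1 ≤ T
  let Q₂ := Q.filter fun q => q.1 * q.2.2.2 ≤ T
  let Q₃ := Q.filter fun q => a * (q.1 * q.2.1 * q.2.2.2) ≤ N₁ + a * T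
  let Q₄ := Q.filter fun q => ∃ e, 0 < e ∧ e ≤ T ∧
    a * (q.2.1 * q.2.2.1 * q.2.2.2) = N₃ + N₁.gcd N₂ * e
  have hcover : Q ⊆ Q₁ ∪ Q₂ ∪ Q₃ ∪ Q₄ := by
    rintro ⟨α, β, γ, δ⟩ hq
    have := (hQ _ hq).small_cases hN hN₁ hN₂ hT
    simp only [Q₁, Q₂, Q₃, Q₄, Finset.mem_union, Finset.mem_filter, hq, true_and]
    tauto
  -- `α β` fixes `α, β` up to a divisor choice, then `γ` divides `N₂ β + N₃ α`, and the equation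
  -- gives `δ`.
  have hc₁ : Q₁.card ≤ T * D ^ 2 := by
    rw [show T = (Finset.Icc 1 T).card by simp]
    refine Finset.card_le_card_mul_sq_of_keys (fun q => q.1 * q.2.1) (fun q => q.1)
      (fun q => q.2.2.1) _ Nat.divisors (fun p α => (N₂ * (p / α) + N₃ * α).divisors)
      ?_ ?_ ?_ ?_ ?_ ?_
    · rintro ⟨α, β, γ, δ⟩ hq
      obtain ⟨hq, hle⟩ := Finset.mem_filter.mp hq
      have h := hQ _ hq
      exact Finset.mem_Icc.mpr ⟨Nat.mul_pos h.pos₁ h.pos₂, hle⟩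
    · rintro ⟨α, β, γ, δ⟩ hq
      obtain ⟨hq, hle⟩ := Finset.mem_filter.mp hq
      have h := hQ _ hq
      exact Nat.mem_divisors.mpr ⟨dvd_mul_right _ _, (Nat.mul_pos h.pos₁ h.pos₂).ne'⟩
    · rintro ⟨α, β, γ, δ⟩ hq
      obtain ⟨hq, hle⟩ := Finset.mem_filter.mp hq
      have h := hQ _ hq
      exact hD _ (Nat.mul_pos h.pos₁ h.pos₂) (by simp only at hle ⊢; omega)
    · rintro ⟨α, β, γ, δ⟩ hq
      obtain ⟨hq, hle⟩ := Finset.mem_filter.mp hq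
      have h := hQ _ hq
      obtain ⟨w, -, -, hw⟩ := h.exists_first hN₂0
      have hα : 0 < α := h.pos₁
      have hβ : 0 < β := h.pos₂
      simp only [Nat.mul_div_cancel_left β hα]
      exact Nat.mem_divisors.mpr ⟨⟨w, by rw [← hw, mul_comm]⟩, by positivity⟩
    · rintro ⟨α, β, γ, δ⟩ hq
      obtain ⟨hq, hle⟩ := Finset.mem_filter.mp hq
      have h := hQ _ hq
      have hα : 0 < α := h.pos₁
      have hβ : 0 < β := h.pos₂
      simp only [Nat.mul_div_cancel_left β hα]
      simp only at hle
      refine hD _ (by positivity) ?_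
      have h1 : α ≤ T := (Nat.le_mul_of_pos_right α hβ).trans hle
      have h2 : β ≤ T := (Nat.le_mul_of_pos_left β hα).trans hle
      calc N₂ * β + N₃ * α ≤ N * (4 * N) + N * (4 * N) :=
            Nat.add_le_add (Nat.mul_le_mul hN₂N (h2.trans hTN))
              (Nat.mul_le_mul hN₃N (h1.trans hTN))
        _ = 8 * N ^ 2 := by ring
        _ ≤ 50 * N ^ 4 := by omega
    · rintro ⟨α, β, γ, δ⟩ hq ⟨α', β', γ', δ'⟩ hq' h1 h2 h3
      have h := hQ _ (Finset.mem_filter.mp hq).1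
      have h' := hQ _ (Finset.mem_filter.mp hq').1
      simp only at h1 h2 h3
      subst h2 h3
      have hα : 0 < α := h.pos₁
      have hβ : 0 < β := h.pos₂
      have hγ : 0 < γ := h.pos₃
      obtain rfl := Nat.eq_of_mul_eq_mul_left hα h1
      have h4 := h.eq.symm.trans h'.eq
      simp only at h4
      obtain rfl : δ = δ' := Nat.eq_of_mul_eq_mul_left
        (by positivity : 0 < a * (α * β * γ))
        (by linarith)
      rfl
  -- `α δ` fixes `α, δ` up to a divisor choice. The missing `β` is found through `w = a α β δ - N₁`,
  -- which divides a number free of `β` and `γ`.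
  have hc₂ : Q₂.card ≤ T * D ^ 2 := by
    rw [show T = (Finset.Icc 1 T).card by simp]
    refine Finset.card_le_card_mul_sq_of_keys (fun q => q.1 * q.2.2.2) (fun q => q.1)
      (fun q => a * (q.1 * q.2.1 * q.2.2.2) - N₁) _ Nat.divisors
      (fun p α => (N₁ * N₂ + a * N₃ * (p * α)).divisors) ?_ ?_ ?_ ?_ ?_ ?_
    · rintro ⟨α, β, γ, δ⟩ hq
      obtain ⟨hq, hle⟩ := Finset.mem_filter.mp hq
      have h := hQ _ hq
      exact Finset.mem_Icc.mpr ⟨Nat.mul_pos h.pos₁ h.pos₄, hle⟩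
    · rintro ⟨α, β, γ, δ⟩ hq
      obtain ⟨hq, hle⟩ := Finset.mem_filter.mp hq
      have h := hQ _ hq
      exact Nat.mem_divisors.mpr ⟨dvd_mul_right _ _, (Nat.mul_pos h.pos₁ h.pos₄).ne'⟩
    · rintro ⟨α, β, γ, δ⟩ hq
      obtain ⟨hq, hle⟩ := Finset.mem_filter.mp hq
      have h := hQ _ hq
      exact hD _ (Nat.mul_pos h.pos₁ h.pos₄) (by simp only at hle ⊢; omega)
    · rintro ⟨α, β, γ, δ⟩ hq
      obtain ⟨hq, hle⟩ := Finset.mem_filter.mp hq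
      have h := hQ _ hq
      obtain ⟨w, -, hw, hwγ⟩ := h.exists_first hN₂0
      simp only [hw, Nat.add_sub_cancel_left]
      refine Nat.mem_divisors.mpr ⟨?_, by positivity⟩
      -- Eliminating `β` between the two relations for `w`; the integers allow the subtraction of
      -- `N₂`.
      have hz : (w : ℤ) * (a * (α * γ * δ) - N₂) = N₁ * N₂ + a * N₃ * (α * δ * α) := by
        have hwz : (a : ℤ) * (α * β * δ) = N₁ + w := by exact_mod_cast hw
        have hwγz : (w : ℤ) * γ = N₂ * β + N₃ * α := by exact_mod_cast hwγ
        linear_combination (a * α * δ : ℤ) * hwγz + (N₂ : ℤ) * hwz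
      exact Int.natCast_dvd_natCast.mp ⟨_, by push_cast; exact hz.symm⟩
    · rintro ⟨α, β, γ, δ⟩ hq
      obtain ⟨hq, hle⟩ := Finset.mem_filter.mp hq
      have h := hQ _ hq
      simp only at hle ⊢
      refine hD _ (by positivity) ?_
      have h1 : α ≤ T := (Nat.le_mul_of_pos_right α h.pos₄).trans hle
      -- The largest number whose divisors are counted; it dictates the range `50 * N ^ 4` in `hD`.
      calc N₁ * N₂ + a * N₃ * (α * δ * α)
          ≤ N * N + (3 * N) * N * ((4 * N) * (4 * N)) :=
            Nat.add_le_add (Nat.mul_le_mul hN₁N hN₂N) (Nat.mul_le_mul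
              (Nat.mul_le_mul (h.a_le.trans (Nat.mul_le_mul_left _ hN₁N)) hN₃N)
              (Nat.mul_le_mul (hle.trans hTN) (h1.trans hTN)))
        _ = N ^ 2 + 48 * N ^ 4 := by ring
        _ ≤ 50 * N ^ 4 := by omega
    · rintro ⟨α, β, γ, δ⟩ hq ⟨α', β', γ', δ'⟩ hq' h1 h2 h3
      have h := hQ _ (Finset.mem_filter.mp hq).1
      have h' := hQ _ (Finset.mem_filter.mp hq').1
      obtain ⟨w, hw0, hw, hwγ⟩ := h.exists_first hN₂0
      obtain ⟨w', -, hw', hwγ'⟩ := h'.exists_first hN₂0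
      simp only [hw, hw', Nat.add_sub_cancel_left] at h1 h2 h3
      subst h2 h3
      have hα : 0 < α := h.pos₁
      have hδ : 0 < δ := h.pos₄
      obtain rfl := Nat.eq_of_mul_eq_mul_left hα h1
      obtain rfl : β = β' := Nat.eq_of_mul_eq_mul_left
        (by positivity : 0 < a * (α * δ))
        (by linarith)
      obtain rfl : γ = γ' := Nat.eq_of_mul_eq_mul_left hw0 (by linarith)
      rfl
  -- `α β δ` lies in an interval of `T` integers just above `N₁ / a`. Two divisor choices split it,
  -- and `w` then gives `γ`.
  have hc₃ : Q₃.card ≤ T * D ^ 2 := by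
    rw [show T = (Finset.Ioc (N₁ / a) (N₁ / a + T)).card by simp]
    refine Finset.card_le_card_mul_sq_of_keys (fun q => q.1 * q.2.1 * q.2.2.2) (fun q => q.1)
      (fun q => q.2.1) _ Nat.divisors (fun p _ => p.divisors) ?_ ?_ ?_ ?_ ?_ ?_
    · rintro ⟨α, β, γ, δ⟩ hq
      obtain ⟨hq, hle⟩ := Finset.mem_filter.mp hq
      have h := hQ _ hq
      obtain ⟨w, hw0, hw, -⟩ := h.exists_first hN₂0
      simp only at hle ⊢
      refine Finset.mem_Ioc.mpr ⟨?_, ?_⟩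
      · rw [Nat.div_lt_iff_lt_mul ha, mul_comm]; omega
      · rw [← Nat.add_mul_div_left _ _ ha, Nat.le_div_iff_mul_le ha, mul_comm]; exact hle
    · rintro ⟨α, β, γ, δ⟩ hq
      have h := hQ _ (Finset.mem_filter.mp hq).1
      exact Nat.mem_divisors.mpr ⟨⟨β * δ, by simp only; ring⟩,
        (Nat.mul_pos (Nat.mul_pos h.pos₁ h.pos₂) h.pos₄).ne'⟩
    · rintro ⟨α, β, γ, δ⟩ hq
      have h := hQ _ (Finset.mem_filter.mp hq).1
      refine hD _ (Nat.mul_pos (Nat.mul_pos h.pos₁ h.pos₂) h.pos₄) ?_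
      have := (Nat.le_mul_of_pos_left (α * β * δ) ha).trans h.mul_le
      simp only
      omega
    · rintro ⟨α, β, γ, δ⟩ hq
      have h := hQ _ (Finset.mem_filter.mp hq).1
      exact Nat.mem_divisors.mpr ⟨⟨α * δ, by simp only; ring⟩,
        (Nat.mul_pos (Nat.mul_pos h.pos₁ h.pos₂) h.pos₄).ne'⟩
    · rintro ⟨α, β, γ, δ⟩ hq
      have h := hQ _ (Finset.mem_filter.mp hq).1
      refine hD _ (Nat.mul_pos (Nat.mul_pos h.pos₁ h.pos₂) h.pos₄) ?_
      have := (Nat.le_mul_of_pos_left (α * β * δ) ha).trans h.mul_le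
      simp only
      omega
    · rintro ⟨α, β, γ, δ⟩ hq ⟨α', β', γ', δ'⟩ hq' h1 h2 h3
      have h := hQ _ (Finset.mem_filter.mp hq).1
      have h' := hQ _ (Finset.mem_filter.mp hq').1
      obtain ⟨w, hw0, hw, hwγ⟩ := h.exists_first hN₂0
      obtain ⟨w', -, hw', hwγ'⟩ := h'.exists_first hN₂0
      simp only at h1 h2 h3
      subst h2 h3
      obtain rfl := Nat.eq_of_mul_eq_mul_left (Nat.mul_pos h.pos₁ h.pos₂) h1
      obtain rfl : w = w' := by omega
      obtain rfl : γ = γ' := Nat.eq_of_mul_eq_mul_left hw0 (by linarith)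
      rfl
  -- `β γ δ` is determined by `e ≤ T`. Two divisor choices split it, and `gcd(N₁, N₂) e α = N₁ γ +
  -- N₂ β` gives `α`.
  have hc₄ : Q₄.card ≤ T * D ^ 2 := by
    refine le_trans (b := ((Finset.Icc 1 T).image fun e => (N₃ + N₁.gcd N₂ * e) / a).card * D ^ 2)
      ?_ (Nat.mul_le_mul_right _ (Finset.card_image_le.trans (by simp)))
    have hbound : ∀ q ∈ Q₄, (q.2.1 * q.2.2.1 * q.2.2.2).divisors.card ≤ D := by
      rintro ⟨α, β, γ, δ⟩ hq
      obtain ⟨hq, e, he0, heT, he⟩ := Finset.mem_filter.mp hq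
      have h := hQ _ hq
      refine hD _ (Nat.mul_pos (Nat.mul_pos h.pos₂ h.pos₃) h.pos₄) ?_
      calc β * γ * δ ≤ a * (β * γ * δ) := Nat.le_mul_of_pos_left _ ha
        _ = N₃ + N₁.gcd N₂ * e := he
        _ ≤ N + N * (4 * N) := Nat.add_le_add hN₃N (Nat.mul_le_mul
            ((Nat.gcd_le_left _ hN₁0).trans hN₁N) (heT.trans hTN))
        _ = N + 4 * N ^ 2 := by ring
        _ ≤ 50 * N ^ 4 := by omega
    refine Finset.card_le_card_mul_sq_of_keys (fun q => q.2.1 * q.2.2.1 * q.2.2.2)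
      (fun q => q.2.1) (fun q => q.2.2.1) _ Nat.divisors (fun p _ => p.divisors)
      ?_ ?_ hbound ?_ hbound ?_
    · rintro ⟨α, β, γ, δ⟩ hq
      obtain ⟨hq, e, he0, heT, he⟩ := Finset.mem_filter.mp hq
      refine Finset.mem_image.mpr ⟨e, Finset.mem_Icc.mpr ⟨he0, heT⟩, ?_⟩
      rw [← he]
      exact Nat.mul_div_cancel_left _ ha
    · rintro ⟨α, β, γ, δ⟩ hq
      have h := hQ _ (Finset.mem_filter.mp hq).1
      exact Nat.mem_divisors.mpr ⟨⟨γ * δ, by simp only; ring⟩,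
        (Nat.mul_pos (Nat.mul_pos h.pos₂ h.pos₃) h.pos₄).ne'⟩
    · rintro ⟨α, β, γ, δ⟩ hq
      have h := hQ _ (Finset.mem_filter.mp hq).1
      exact Nat.mem_divisors.mpr ⟨⟨β * δ, by simp only; ring⟩,
        (Nat.mul_pos (Nat.mul_pos h.pos₂ h.pos₃) h.pos₄).ne'⟩
    · rintro ⟨α, β, γ, δ⟩ hq ⟨α', β', γ', δ'⟩ hq' h1 h2 h3
      have h := hQ _ (Finset.mem_filter.mp hq).1
      have h' := hQ _ (Finset.mem_filter.mp hq').1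
      obtain ⟨e, he0, he, heα⟩ := h.exists_third hN₁0
      obtain ⟨e', -, he', heα'⟩ := h'.exists_third hN₁0
      simp only at h1 h2 h3
      subst h2 h3
      have hg : 0 < N₁.gcd N₂ := Nat.gcd_pos_of_pos_left _ hN₁0
      obtain rfl := Nat.eq_of_mul_eq_mul_left (Nat.mul_pos h.pos₂ h.pos₃) h1
      obtain rfl : e = e' := Nat.eq_of_mul_eq_mul_left hg (by omega)
      obtain rfl : α = α' := Nat.eq_of_mul_eq_mul_left (Nat.mul_pos hg he0) (by linarith)
      rfl
  calc Q.card ≤ (Q₁ ∪ Q₂ ∪ Q₃ ∪ Q₄).card := Finset.card_le_card hcover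
    _ ≤ Q₁.card + Q₂.card + Q₃.card + Q₄.card := by
        refine (Finset.card_union_le _ _).trans (Nat.add_le_add_right ?_ _)
        refine (Finset.card_union_le _ _).trans (Nat.add_le_add_right ?_ _)
        exact Finset.card_union_le _ _
    _ ≤ 4 * T * D ^ 2 := by linarith

/-! ### Parametrisation of three unit fractions -/

theorem Nat.gcd_lcm_eq_lcm_gcd {a b c : ℕ} (ha : a ≠ 0) (hb : b ≠ 0) (hc : c ≠ 0) :
    a.gcd (b.lcm c) = (a.gcd b).lcm (a.gcd c) := by
  have hab : a.gcd b ≠ 0 := Nat.gcd_ne_zero_left ha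
  have hac : a.gcd c ≠ 0 := Nat.gcd_ne_zero_left ha
  refine Nat.eq_of_factorization_eq (Nat.gcd_ne_zero_left ha) (Nat.lcm_ne_zero hab hac) fun p => ?_
  rw [Nat.factorization_gcd ha (Nat.lcm_ne_zero hb hc), Nat.factorization_lcm hb hc,
    Nat.factorization_lcm hab hac, Nat.factorization_gcd ha hb, Nat.factorization_gcd ha hc]
  simp only [Finsupp.inf_apply, Finsupp.sup_apply, inf_sup_left]

/-- Three positive integers, each dividing the lcm of the other two, are
`α β δ`, `α γ δ`, `β γ δ`. -/
theorem Nat.exists_relative_gcds {t₁ t₂ t₃ : ℕ} (h₁ : 0 < t₁) (h₂ : 0 < t₂) (h₃ : 0 < t₃)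
    (d₁ : t₁ ∣ t₂.lcm t₃) (d₂ : t₂ ∣ t₁.lcm t₃) (d₃ : t₃ ∣ t₁.lcm t₂) :
    ∃ α β γ δ, t₁ = α * β * δ ∧ t₂ = α * γ * δ ∧ t₃ = β * γ * δ := by
  set δ := (t₁.gcd t₂).gcd t₃ with hδ
  have hδ0 : 0 < δ := Nat.gcd_pos_of_pos_right _ h₃
  -- Distributivity makes `s` the lcm of its gcds with `r` and `u`. Since these have gcd `δ`, the
  -- product formula reads `δ s = (δ p) (δ q)`.
  have key : ∀ {s r u p q : ℕ}, 0 < s → 0 < r → 0 < u → s ∣ r.lcm u → s.gcd r = δ * p →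
      s.gcd u = δ * q → (s.gcd r).gcd (s.gcd u) = δ → s = p * q * δ := by
    intro s r u p q hs hr hu hd hp hq hg
    have h1 : s = (s.gcd r).lcm (s.gcd u) := by
      rw [← Nat.gcd_lcm_eq_lcm_gcd hs.ne' hr.ne' hu.ne', Nat.gcd_eq_left hd]
    have h2 := Nat.gcd_mul_lcm (s.gcd r) (s.gcd u)
    rw [hg, ← h1, hp, hq] at h2
    refine Nat.eq_of_mul_eq_mul_left hδ0 ?_
    rw [h2]; ring
  obtain ⟨α, hα⟩ : δ ∣ t₁.gcd t₂ := Nat.gcd_dvd_left _ _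
  obtain ⟨β, hβ⟩ : δ ∣ t₁.gcd t₃ := Nat.dvd_gcd
    ((Nat.gcd_dvd_left _ _).trans (Nat.gcd_dvd_left _ _)) (Nat.gcd_dvd_right _ _)
  obtain ⟨γ, hγ⟩ : δ ∣ t₂.gcd t₃ := Nat.dvd_gcd
    ((Nat.gcd_dvd_left _ _).trans (Nat.gcd_dvd_right _ _)) (Nat.gcd_dvd_right _ _)
  have e : ∀ {s r u : ℕ}, (s.gcd r).gcd (s.gcd u) = (s.gcd r).gcd u := by
    intro s r u
    refine Nat.dvd_antisymm (Nat.dvd_gcd (Nat.gcd_dvd_left _ _)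
      ((Nat.gcd_dvd_right _ _).trans (Nat.gcd_dvd_right _ _))) (Nat.dvd_gcd (Nat.gcd_dvd_left _ _)
      (Nat.dvd_gcd ((Nat.gcd_dvd_left _ _).trans (Nat.gcd_dvd_left _ _)) (Nat.gcd_dvd_right _ _)))
  refine ⟨α, β, γ, δ, key h₁ h₂ h₃ d₁ hα hβ e, ?_, ?_⟩
  · refine key h₂ h₁ h₃ d₂ (by rw [Nat.gcd_comm, hα]) hγ ?_
    rw [e, Nat.gcd_comm t₂ t₁]
  · refine key h₃ h₁ h₂ d₃ (by rw [Nat.gcd_comm, hβ]) (by rw [Nat.gcd_comm, hγ]) ?_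
    rw [e, hδ, Nat.gcd_assoc, Nat.gcd_comm]

/-- In `N₁ / t₁ + N₂ / t₂ + N₃ / t₃ = a`, multiplying by `lcm(t₂, t₃)` clears the last two
denominators, so `t₁` divides `N₁ * lcm(t₂, t₃)`. -/
theorem dvd_lcm_of_sum_eq {a N₁ N₂ N₃ t₁ t₂ t₃ : ℕ} (h₂ : 0 < t₂) (h₃ : 0 < t₃)
    (hc : Nat.Coprime t₁ N₁)
    (heq : N₁ * (t₂ * t₃) + N₂ * (t₁ * t₃) + N₃ * (t₁ * t₂) = a * (t₁ * t₂ * t₃)) :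
    t₁ ∣ t₂.lcm t₃ := by
  obtain ⟨u, hu⟩ := Nat.dvd_lcm_left t₂ t₃
  obtain ⟨v, hv⟩ := Nat.dvd_lcm_right t₂ t₃
  set L := t₂.lcm t₃
  have h : N₁ * L + t₁ * (N₂ * u + N₃ * v) = t₁ * (a * L) := by
    refine Nat.eq_of_mul_eq_mul_left (by positivity : 0 < t₂ * t₃) ?_
    calc t₂ * t₃ * (N₁ * L + t₁ * (N₂ * u + N₃ * v))
        = N₁ * (t₂ * t₃) * L + N₂ * (t₁ * t₃) * (t₂ * u) + N₃ * (t₁ * t₂) * (t₃ * v) := by ring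
      _ = (N₁ * (t₂ * t₃) + N₂ * (t₁ * t₃) + N₃ * (t₁ * t₂)) * L := by
          rw [← hu, ← hv]; ring
      _ = _ := by rw [heq]; ring
  refine hc.dvd_of_dvd_mul_left ?_
  exact (Nat.dvd_add_iff_left (dvd_mul_right _ _)).mpr (h ▸ dvd_mul_right _ _)

/-- The relative gcd parametrisation of the solutions of `1/x + 1/y + 1/z = a/N`. -/
theorem exists_gcdQuadruple {a N x y z : ℕ} (hN : 0 < N) (hx : 0 < x) (hxy : x ≤ y) (hyz : y ≤ z)
    (heq : (1 / x + 1 / y + 1 / z : ℚ) = a / N) :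
    ∃ q : ℕ × ℕ × ℕ × ℕ,
      IsGcdQuadruple a (N / x.gcd N) (N / y.gcd N) (N / z.gcd N) q ∧
      x = x.gcd N * (q.1 * q.2.1 * q.2.2.2) ∧ y = y.gcd N * (q.1 * q.2.2.1 * q.2.2.2) ∧
      z = z.gcd N * (q.2.1 * q.2.2.1 * q.2.2.2) := by
  have hy : 0 < y := hx.trans_le hxy
  have hz : 0 < z := hy.trans_le hyz
  have split : ∀ s : ℕ, 0 < s → ∃ n t M, 0 < n ∧ 0 < t ∧ 0 < M ∧ s.gcd N = n ∧ s = n * t ∧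
      N = n * M ∧ N / s.gcd N = M ∧ Nat.Coprime t M := by
    intro s hs
    have hg : 0 < s.gcd N := Nat.gcd_pos_of_pos_left _ hs
    refine ⟨s.gcd N, s / s.gcd N, N / s.gcd N, hg,
      Nat.div_pos (Nat.le_of_dvd hs (Nat.gcd_dvd_left _ _)) hg,
      Nat.div_pos (Nat.le_of_dvd hN (Nat.gcd_dvd_right _ _)) hg, rfl,
      (Nat.mul_div_cancel' (Nat.gcd_dvd_left _ _)).symm,
      (Nat.mul_div_cancel' (Nat.gcd_dvd_right _ _)).symm, rfl, Nat.coprime_div_gcd_div_gcd hg⟩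
  obtain ⟨n₁, t₁, N₁, hn₁, ht₁, hN₁, g₁, x₁, e₁, q₁, c₁⟩ := split x hx
  obtain ⟨n₂, t₂, N₂, hn₂, ht₂, hN₂, g₂, x₂, e₂, q₂, c₂⟩ := split y hy
  obtain ⟨n₃, t₃, N₃, hn₃, ht₃, hN₃, g₃, x₃, e₃, q₃, c₃⟩ := split z hz
  rw [q₁, q₂, q₃, g₁, g₂, g₃]
  -- With `s = n t` and `N = n M` for `n = gcd(s, N)`, the fraction `N / s` becomes the reduced
  -- fraction `M / t`.
  have hsum : N₁ * (t₂ * t₃) + N₂ * (t₁ * t₃) + N₃ * (t₁ * t₂) = a * (t₁ * t₂ * t₃) := by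
    have frac : ∀ {s n t M : ℕ}, 0 < n → 0 < t → s = n * t → N = n * M →
        (N * (1 / s) : ℚ) = M / t := by
      intro s n t M hn ht hs hM
      have : (n : ℚ) ≠ 0 := by positivity
      have : (t : ℚ) ≠ 0 := by positivity
      rw [hs, hM]; push_cast; field_simp
    have hNq : (N : ℚ) ≠ 0 := by positivity
    have h : (N₁ / t₁ + N₂ / t₂ + N₃ / t₃ : ℚ) = a := by
      rw [← frac hn₁ ht₁ x₁ e₁, ← frac hn₂ ht₂ x₂ e₂, ← frac hn₃ ht₃ x₃ e₃, ← mul_add, ← mul_add,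
        heq, mul_div_cancel₀ _ hNq]
    have : (t₁ : ℚ) ≠ 0 := by positivity
    have : (t₂ : ℚ) ≠ 0 := by positivity
    have : (t₃ : ℚ) ≠ 0 := by positivity
    field_simp at h
    have h' : (N₁ * (t₂ * t₃) + N₂ * (t₁ * t₃) + N₃ * (t₁ * t₂) : ℚ) = a * (t₁ * t₂ * t₃) := by
      linarith
    exact_mod_cast h'
  obtain ⟨α, β, γ, δ, r₁, r₂, r₃⟩ := Nat.exists_relative_gcds ht₁ ht₂ ht₃
    (dvd_lcm_of_sum_eq (a := a) (N₂ := N₂) (N₃ := N₃) ht₂ ht₃ c₁ hsum)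
    (dvd_lcm_of_sum_eq (a := a) (N₂ := N₁) (N₃ := N₃) ht₁ ht₃ c₂ (by linarith))
    (dvd_lcm_of_sum_eq (a := a) (N₂ := N₁) (N₃ := N₂) ht₁ ht₂ c₃ (by linarith))
  have hα : 0 < α := Nat.pos_of_ne_zero (by rintro rfl; simp at r₁; omega)
  have hβ : 0 < β := Nat.pos_of_ne_zero (by rintro rfl; simp at r₁; omega)
  have hγ : 0 < γ := Nat.pos_of_ne_zero (by rintro rfl; simp at r₂; omega)
  have hδ : 0 < δ := Nat.pos_of_ne_zero (by rintro rfl; simp at r₂; omega)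
  have hle : ∀ {s s' n n' M M' c p p' : ℕ}, 0 < n → 0 < n' → 0 < c → s ≤ s' → s = n * (p * c) →
      s' = n' * (p' * c) → N = n * M → N = n' * M' → M' * p ≤ M * p' := by
    intro s s' n n' M M' c p p' hn hn' hc hss hs hs' hM hM'
    refine le_of_mul_le_mul_left (a := n * n' * c) ?_ (by positivity)
    calc n * n' * c * (M' * p) = (n' * M') * (n * (p * c)) := by ring
      _ ≤ (n * M) * (n' * (p' * c)) := by
          rw [← hM, ← hM', ← hs, ← hs']; exact Nat.mul_le_mul_left _ hss
      _ = _ := by ring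
  refine ⟨(α, β, γ, δ), ⟨hα, hβ, hγ, hδ, ?_, ?_, ?_, ?_⟩, ?_, ?_, ?_⟩
  · simp only
    refine Nat.eq_of_mul_eq_mul_left (by positivity : 0 < α * β * γ * δ * δ) ?_
    rw [r₁, r₂, r₃] at hsum
    linarith
  · exact hle hn₁ hn₂ (by positivity : 0 < α * δ) hxy (by rw [x₁, r₁]; ring)
      (by rw [x₂, r₂]; ring) e₁ e₂
  · exact hle hn₂ hn₃ (by positivity : 0 < γ * δ) hyz (by rw [x₂, r₂]; ring)
      (by rw [x₃, r₃]; ring) e₂ e₃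
  · exact Nat.Coprime.coprime_dvd_left ⟨β * δ, by rw [r₁]; ring⟩ c₁
  · rw [← r₁]; exact x₁
  · rw [← r₂]; exact x₂
  · rw [← r₃]; exact x₃

/-- The increasing `k`-tuples of positive integers whose reciprocals sum to `a / n`. -/
def unitFractionSolutions (k a n : ℕ) : Set (Fin k → ℕ) :=
  {x | (∀ i, 0 < x i) ∧ Monotone x ∧ ∑ i, (1 / x i : ℚ) = a / n}

/-- Bound for three unit fractions in terms of a bound `D` for the divisor function. -/
theorem card_three_unitFractions_le {a N T D : ℕ} (ha : 0 < a) (hN : 0 < N)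
    (hT : 36 * N ^ 3 ≤ a ^ 3 * T ^ 5) (hTN : T ≤ 4 * N)
    (hD : ∀ k, 0 < k → k ≤ 50 * N ^ 4 → k.divisors.card ≤ D)
    (S : Finset (Fin 3 → ℕ)) (hS : ∀ x ∈ S, x ∈ unitFractionSolutions 3 a N) :
    S.card ≤ 4 * T * D ^ 5 := by
  classical
  have hDN : N.divisors.card ≤ D :=
    hD N hN (by have := Nat.le_self_pow (n := 4) (by norm_num) N; omega)
  have hex : ∀ x ∈ S, ∃ q : ℕ × ℕ × ℕ × ℕ,
      IsGcdQuadruple a (N / (x 0).gcd N) (N / (x 1).gcd N) (N / (x 2).gcd N) q ∧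
      x 0 = (x 0).gcd N * (q.1 * q.2.1 * q.2.2.2) ∧
      x 1 = (x 1).gcd N * (q.1 * q.2.2.1 * q.2.2.2) ∧
      x 2 = (x 2).gcd N * (q.2.1 * q.2.2.1 * q.2.2.2) := by
    intro x hx
    obtain ⟨hpos, hmono, hsum⟩ := hS x hx
    rw [Fin.sum_univ_three] at hsum
    exact exists_gcdQuadruple hN (hpos 0) (hmono (by decide)) (hmono (by decide)) hsum
  choose! q hq h0 h1 h2 using hex
  -- The three gcds with `N` cost `D ^ 3`; together with the quadruple they determine `x`.
  let K := N.divisors ×ˢ N.divisors ×ˢ N.divisors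
  have hK : K.card ≤ D ^ 3 := by
    simp only [K, Finset.card_product]
    calc _ ≤ D * (D * D) := Nat.mul_le_mul hDN (Nat.mul_le_mul hDN hDN)
      _ = D ^ 3 := by ring
  have hmem : ∀ s : ℕ, s.gcd N ∈ N.divisors := fun s =>
    Nat.mem_divisors.mpr ⟨Nat.gcd_dvd_right _ _, hN.ne'⟩
  calc S.card ≤ (4 * T * D ^ 2) * K.card := by
        refine Finset.card_le_mul_card_image_of_maps_to
          (f := fun x => ((x 0).gcd N, (x 1).gcd N, (x 2).gcd N)) (fun x _ => ?_) _ ?_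
        · simp only [K, Finset.mem_product]
          exact ⟨hmem _, hmem _, hmem _⟩
        · rintro ⟨n₁, n₂, n₃⟩ hn
          simp only [K, Finset.mem_product] at hn
          have hinj : Set.InjOn q
              (S.filter fun x => ((x 0).gcd N, (x 1).gcd N, (x 2).gcd N) = (n₁, n₂, n₃)) := by
            intro x hx y hy hxy
            simp only [Finset.coe_filter, Set.mem_ofPred_eq, Prod.mk.injEq] at hx hy
            obtain ⟨hx, gx0, gx1, gx2⟩ := hx
            obtain ⟨hy, gy0, gy1, gy2⟩ := hy
            funext i
            fin_cases i
            · change x 0 = y 0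
              rw [h0 x hx, h0 y hy, gx0, gy0, hxy]
            · change x 1 = y 1
              rw [h1 x hx, h1 y hy, gx1, gy1, hxy]
            · change x 2 = y 2
              rw [h2 x hx, h2 y hy, gx2, gy2, hxy]
          rw [← Finset.card_image_of_injOn hinj]
          refine card_gcdQuadruples_le ha hN
            (Nat.div_dvd_of_dvd (Nat.dvd_of_mem_divisors hn.1))
            (Nat.div_dvd_of_dvd (Nat.dvd_of_mem_divisors hn.2.1))
            (Nat.div_dvd_of_dvd (Nat.dvd_of_mem_divisors hn.2.2)) hT hTN hD _ ?_
          intro r hr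
          obtain ⟨x, hx, rfl⟩ := Finset.mem_image.mp hr
          simp only [Finset.mem_filter, Prod.mk.injEq] at hx
          obtain ⟨hx, g0, g1, g2⟩ := hx
          have := hq x hx
          rwa [g0, g1, g2] at this
    _ ≤ (4 * T * D ^ 2) * D ^ 3 := Nat.mul_le_mul_left _ hK
    _ = 4 * T * D ^ 5 := by ring

/-! ### Removing the smallest denominator -/

/-- The possible smallest denominators in a sum of `k` unit fractions equal to `a / n`. -/
def firstDenominators (k a n : ℕ) : Finset ℕ :=
  (Finset.range (k * n + 1)).filter fun x => n < a * x ∧ a * x ≤ k * n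

theorem mem_firstDenominators {k a n x : ℕ} (h : x ∈ firstDenominators k a n) :
    n < a * x ∧ a * x ≤ k * n :=
  (Finset.mem_filter.mp h).2

/-- The largest unit fraction is smaller than the whole sum, as others remain, and at least the
average. -/
theorem head_mem_firstDenominators {k a n : ℕ} (hk : 0 < k) (ha : 0 < a) (hn : 0 < n)
    {x : Fin (k + 1) → ℕ} (hx : x ∈ unitFractionSolutions (k + 1) a n) :
    x 0 ∈ firstDenominators (k + 1) a n := by
  obtain ⟨hpos, hmono, hsum⟩ := hx
  have hx0 : (0 : ℚ) < x 0 := by exact_mod_cast hpos 0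
  have hnq : (0 : ℚ) < n := by exact_mod_cast hn
  have h1 : n < a * x 0 := by
    rw [Fin.sum_univ_succ] at hsum
    have htail : 0 < ∑ i : Fin k, (1 / x i.succ : ℚ) := by
      refine Finset.sum_pos (fun i _ => ?_) ⟨⟨0, hk⟩, Finset.mem_univ _⟩
      have : (0 : ℚ) < x i.succ := by exact_mod_cast hpos _
      positivity
    have : (1 / x 0 : ℚ) < a / n := by linarith
    rw [div_lt_div_iff₀ hx0 hnq, one_mul] at this
    exact_mod_cast this
  have h2 : a * x 0 ≤ (k + 1) * n := by
    have : (a / n : ℚ) ≤ (k + 1 : ℕ) / x 0 := by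
      rw [← hsum]
      calc ∑ i, (1 / x i : ℚ) ≤ ∑ _i : Fin (k + 1), (1 / x 0 : ℚ) := by
            refine Finset.sum_le_sum fun i _ => one_div_le_one_div_of_le hx0 ?_
            exact_mod_cast hmono (Fin.zero_le i)
        _ = _ := by simp [div_eq_mul_inv]
    rw [div_le_div_iff₀ hnq hx0] at this
    exact_mod_cast this
  refine Finset.mem_filter.mpr ⟨Finset.mem_range.mpr ?_, h1, h2⟩
  have := Nat.le_mul_of_pos_left (x 0) ha
  omega

/-- This is `a / n - 1 / x = (a x - n) / (n x)`; the strict bound on `x 0` makes the truncated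
subtraction genuine. -/
theorem tail_mem_unitFractionSolutions {k a n : ℕ} (hk : 0 < k) (ha : 0 < a) (hn : 0 < n)
    {x : Fin (k + 1) → ℕ} (hx : x ∈ unitFractionSolutions (k + 1) a n) :
    Fin.tail x ∈ unitFractionSolutions k (a * x 0 - n) (n * x 0) := by
  have hlt := (mem_firstDenominators (head_mem_firstDenominators hk ha hn hx)).1
  obtain ⟨hpos, hmono, hsum⟩ := hx
  refine ⟨fun i => hpos _, fun i j hij => hmono (Fin.succ_le_succ_iff.mpr hij), ?_⟩
  have hx0 : (x 0 : ℚ) ≠ 0 := by exact_mod_cast (hpos 0).ne'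
  have hnq : (n : ℚ) ≠ 0 := by exact_mod_cast hn.ne'
  rw [Fin.sum_univ_succ] at hsum
  have : ∑ i : Fin k, (1 / (Fin.tail x) i : ℚ) = a / n - 1 / x 0 := by
    rw [← hsum]; simp [Fin.tail]
  rw [this, Nat.cast_sub hlt.le]
  push_cast
  field_simp

theorem unitFractionSolutions_one_subsingleton (a n : ℕ) :
    (unitFractionSolutions 1 a n).Subsingleton := by
  rintro x ⟨_, _, hx⟩ y ⟨_, _, hy⟩
  simp only [Fin.sum_univ_one] at hx hy
  have := hx.trans hy.symm
  funext i
  rw [Subsingleton.elim i 0]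
  rw [one_div, one_div, inv_inj] at this
  exact_mod_cast this

theorem unitFractionSolutions_succ_subset {k a n : ℕ} (hk : 0 < k) (ha : 0 < a) (hn : 0 < n) :
    unitFractionSolutions (k + 1) a n ⊆ ⋃ x ∈ firstDenominators (k + 1) a n,
      (fun y : Fin k → ℕ => (Fin.cons x y : Fin (k + 1) → ℕ)) ''
        unitFractionSolutions k (a * x - n) (n * x) := by
  intro x hx
  simp only [Set.mem_iUnion]
  exact ⟨x 0, head_mem_firstDenominators hk ha hn hx, Fin.tail x,
    tail_mem_unitFractionSolutions hk ha hn hx, Fin.cons_self_tail x⟩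

/-- Needed in its own right: `Set.ncard` is zero on infinite sets, so the counting bounds alone
would be empty. -/
theorem unitFractionSolutions_finite {k : ℕ} (hk : 0 < k) :
    ∀ {a n : ℕ}, 0 < a → 0 < n → (unitFractionSolutions k a n).Finite := by
  induction k, hk using Nat.le_induction with
  | base => exact fun _ _ => (unitFractionSolutions_one_subsingleton _ _).finite
  | succ k hk ih =>
    intro a n ha hn
    refine Set.Finite.subset ?_ (unitFractionSolutions_succ_subset hk ha hn)
    refine Set.Finite.biUnion (Finset.finite_toSet _) fun x hx => Set.Finite.image _ ?_
    have := (mem_firstDenominators hx).1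
    refine ih (by omega) (Nat.mul_pos hn (Nat.pos_of_ne_zero ?_))
    rintro rfl
    simp at this

theorem ncard_unitFractionSolutions_succ_le {k a n : ℕ} (hk : 0 < k) (ha : 0 < a) (hn : 0 < n) :
    (unitFractionSolutions (k + 1) a n).ncard ≤ ∑ x ∈ firstDenominators (k + 1) a n,
      (unitFractionSolutions k (a * x - n) (n * x)).ncard := by
  classical
  have hfin := unitFractionSolutions_finite (Nat.succ_pos k) ha hn
  have hf : ∀ x ∈ firstDenominators (k + 1) a n,
      (unitFractionSolutions k (a * x - n) (n * x)).Finite := by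
    intro x hx
    have := (mem_firstDenominators hx).1
    refine unitFractionSolutions_finite hk (by omega) (Nat.mul_pos hn (Nat.pos_of_ne_zero ?_))
    rintro rfl
    simp at this
  calc (unitFractionSolutions (k + 1) a n).ncard = hfin.toFinset.card :=
        Set.ncard_eq_toFinset_card _ hfin
    _ = ∑ x ∈ firstDenominators (k + 1) a n, (hfin.toFinset.filter fun y => y 0 = x).card :=
        Finset.card_eq_sum_card_fiberwise fun y hy =>
          head_mem_firstDenominators hk ha hn (hfin.mem_toFinset.mp hy)
    _ ≤ _ := by
        refine Finset.sum_le_sum fun x hx => ?_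
        rw [Set.ncard_eq_toFinset_card _ (hf x hx)]
        refine Finset.card_le_card_of_injOn Fin.tail (fun y hy => ?_) (fun y hy z hz hyz => ?_)
        · simp only [Finset.coe_filter, Set.Finite.mem_toFinset, Set.mem_ofPred_eq] at hy
          obtain ⟨hy, rfl⟩ := hy
          simpa using tail_mem_unitFractionSolutions hk ha hn hy
        · simp only [Finset.coe_filter, Set.mem_ofPred_eq] at hy hz
          rw [← Fin.cons_self_tail y, ← Fin.cons_self_tail z, hyz, hy.2, hz.2]

/-! ### Three, four and five unit fractions -/

/-- Three unit fractions: `1/x + 1/y + 1/z = a/n` has `O_ε(n ^ ε (n / a) ^ (3 / 5))` solutions. -/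
theorem exists_ncard_three_unitFractions_le (ε : ℝ) (hε : 0 < ε) :
    ∃ C : ℝ, 0 < C ∧ ∀ a n : ℕ, 0 < a → 0 < n →
      ((unitFractionSolutions 3 a n).ncard : ℝ) ≤
        C * (n : ℝ) ^ ε * ((n : ℝ) / a) ^ (3 / 5 : ℝ) := by
  -- The divisor function is taken up to `50 n ^ 4` and raised to the fifth power, hence `20 = 4 *
  -- 5`.
  obtain ⟨C, hC1, hC⟩ := Nat.exists_card_divisors_le_rpow (ε / 20) (by positivity)
  have hC0 : 0 < C := by linarith
  refine ⟨24 * (C * 50 ^ (ε / 20)) ^ 5, by positivity, fun a n ha hn => ?_⟩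
  have hn1 : (1 : ℝ) ≤ n := by exact_mod_cast hn
  have ha1 : (1 : ℝ) ≤ a := by exact_mod_cast ha
  have ha0 : (0 : ℝ) < a := by linarith
  obtain h0 | ⟨x, hx⟩ := (unitFractionSolutions 3 a n).eq_empty_or_nonempty
  · rw [h0, Set.ncard_empty, Nat.cast_zero]; positivity
  have han : a ≤ 3 * n := by
    have hm := head_mem_firstDenominators (by norm_num) ha hn hx
    have := Nat.le_mul_of_pos_right a (hx.1 0)
    have := (mem_firstDenominators hm).2
    omega
  set y : ℝ := ((n : ℝ) / a) ^ (3 / 5 : ℝ) with hy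
  have hy0 : 0 ≤ y := by positivity
  have hy5 : y ^ 5 = ((n : ℝ) / a) ^ 3 := by
    rw [hy, ← Real.rpow_natCast, ← Real.rpow_mul (by positivity)]
    norm_num
  -- This lower bound absorbs the rounding in `T`, giving `T ≤ 3 y + 1 ≤ 6 y`.
  have hylow : 1 / 3 ≤ y := by
    have h3 : (1 / 3 : ℝ) ≤ n / a := by
      rw [div_le_div_iff₀ (by norm_num) ha0]
      have : (a : ℝ) ≤ 3 * n := by exact_mod_cast han
      linarith
    calc (1 / 3 : ℝ) = (1 / 3 : ℝ) ^ (1 : ℝ) := (Real.rpow_one _).symm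
      _ ≤ (1 / 3 : ℝ) ^ (3 / 5 : ℝ) :=
          Real.rpow_le_rpow_of_exponent_ge (by norm_num) (by norm_num) (by norm_num)
      _ ≤ y := Real.rpow_le_rpow (by norm_num) h3 (by norm_num)
  have hyup : y ≤ n := by
    calc y ≤ (n : ℝ) ^ (3 / 5 : ℝ) :=
          Real.rpow_le_rpow (by positivity) (div_le_self (by linarith) ha1) (by norm_num)
      _ ≤ (n : ℝ) ^ (1 : ℝ) := Real.rpow_le_rpow_of_exponent_le hn1 (by norm_num)
      _ = n := Real.rpow_one _
  set T := ⌈3 * y⌉₊ with hT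
  have hTlow : 3 * y ≤ T := Nat.le_ceil _
  have hTup : (T : ℝ) < 3 * y + 1 := Nat.ceil_lt_add_one (by positivity)
  have hT5 : 36 * n ^ 3 ≤ a ^ 3 * T ^ 5 := by
    have : (36 * n ^ 3 : ℝ) ≤ a ^ 3 * T ^ 5 := by
      calc (36 * n ^ 3 : ℝ) ≤ 243 * n ^ 3 := by gcongr; norm_num
        _ = a ^ 3 * (3 * y) ^ 5 := by rw [mul_pow, hy5]; field_simp; norm_num
        _ ≤ a ^ 3 * T ^ 5 := by gcongr
    exact_mod_cast this
  have hTn : T ≤ 4 * n := by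
    have : (T : ℝ) ≤ 4 * n := by linarith
    exact_mod_cast this
  set B : ℝ := C * 50 ^ (ε / 20) * (n : ℝ) ^ (ε / 5) with hB
  have hB0 : 0 ≤ B := by positivity
  have hD : ∀ k, 0 < k → k ≤ 50 * n ^ 4 → k.divisors.card ≤ ⌊B⌋₊ := by
    intro k hk hkn
    refine Nat.le_floor ((hC k hk.ne').trans ?_)
    rw [hB, mul_assoc]
    refine mul_le_mul_of_nonneg_left ?_ hC0.le
    calc (k : ℝ) ^ (ε / 20) ≤ (50 * (n : ℝ) ^ 4) ^ (ε / 20) :=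
          Real.rpow_le_rpow (by positivity) (by exact_mod_cast hkn) (by positivity)
      _ = 50 ^ (ε / 20) * (n : ℝ) ^ (ε / 5) := by
          rw [Real.mul_rpow (by norm_num) (by positivity), ← Real.rpow_natCast (n : ℝ) 4,
            ← Real.rpow_mul (by positivity)]
          congr 2
          push_cast; ring
  have hfin := unitFractionSolutions_finite (k := 3) (by norm_num) ha hn
  rw [Set.ncard_eq_toFinset_card _ hfin]
  have hcard := card_three_unitFractions_le ha hn hT5 hTn hD hfin.toFinset
    (fun x hx => hfin.mem_toFinset.mp hx)
  calc (hfin.toFinset.card : ℝ) ≤ 4 * T * (⌊B⌋₊ : ℝ) ^ 5 := by exact_mod_cast hcard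
    _ ≤ 4 * (6 * y) * B ^ 5 := by
        gcongr
        · linarith
        · exact Nat.floor_le hB0
    _ = 24 * (C * 50 ^ (ε / 20)) ^ 5 * (n : ℝ) ^ ε * y := by
        have : ((n : ℝ) ^ (ε / 5)) ^ 5 = (n : ℝ) ^ ε := by
          rw [← Real.rpow_natCast, ← Real.rpow_mul (by positivity)]
          congr 1; push_cast; ring
        rw [hB, mul_pow, this]; ring

theorem pos_of_mem_firstDenominators {k a n x : ℕ} (h : x ∈ firstDenominators k a n) : 0 < x := by
  have := (mem_firstDenominators h).1
  refine Nat.pos_of_ne_zero ?_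
  rintro rfl
  simp at this

/-- Turns sums over `x` into sums over distinct positive integers `b = a x - n`. -/
theorem sub_injOn_firstDenominators {k a n : ℕ} (ha : 0 < a) :
    Set.InjOn (fun x => a * x - n) (firstDenominators k a n) := by
  intro x hx y hy hxy
  have h1 := (mem_firstDenominators hx).1
  have h2 := (mem_firstDenominators hy).1
  simp only at hxy
  exact Nat.eq_of_mul_eq_mul_left ha (by omega)

/-- The sum of `b ^ (-3/5)` over the `b = a x - n` uses that they lie in one class modulo `a`. -/
theorem sum_firstDenominators_rpow_le {k a n : ℕ} (ha : 0 < a) :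
    ∑ x ∈ firstDenominators k a n, ((a * x - n : ℕ) : ℝ) ^ (-(3 / 5) : ℝ) ≤
      1 + 5 / 2 * (k : ℝ) ^ (2 / 5 : ℝ) * ((n : ℝ) ^ (2 / 5 : ℝ) / a) := by
  classical
  have ha0 : (0 : ℝ) < a := by exact_mod_cast ha
  -- The least candidate may give `b = 1` and is bounded by `1`. The others are `x₀ + j` with `b ≥ a
  -- j`, which is where the saving of a factor `a` comes from.
  set x₀ := n / a + 1
  set M := k * n / a
  have hx₀ : n < a * x₀ := Nat.lt_mul_div_succ n ha
  have hsub : firstDenominators k a n ⊆ insert x₀ ((Finset.Icc 1 M).image fun j => x₀ + j) := by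
    intro x hx
    obtain ⟨h1, h2⟩ := mem_firstDenominators hx
    have h3 : n / a < x := (Nat.div_lt_iff_lt_mul ha).mpr (by rwa [mul_comm])
    have h4 : x ≤ M := (Nat.le_div_iff_mul_le ha).mpr (by rwa [mul_comm])
    rw [Finset.mem_insert, Finset.mem_image]
    rcases Nat.eq_or_lt_of_le (show x₀ ≤ x from h3) with h | h
    · exact Or.inl h.symm
    · exact Or.inr ⟨x - x₀, Finset.mem_Icc.mpr ⟨Nat.sub_pos_of_lt h,
        (Nat.sub_le _ _).trans h4⟩, Nat.add_sub_cancel' h.le⟩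
  have hnot : x₀ ∉ (Finset.Icc 1 M).image fun j => x₀ + j := by
    simp only [Finset.mem_image, Finset.mem_Icc, not_exists, not_and]
    intro j hj h
    omega
  calc ∑ x ∈ firstDenominators k a n, ((a * x - n : ℕ) : ℝ) ^ (-(3 / 5) : ℝ)
      ≤ ∑ x ∈ insert x₀ ((Finset.Icc 1 M).image fun j => x₀ + j),
          ((a * x - n : ℕ) : ℝ) ^ (-(3 / 5) : ℝ) :=
        Finset.sum_le_sum_of_subset_of_nonneg hsub fun _ _ _ => by positivity
    _ = ((a * x₀ - n : ℕ) : ℝ) ^ (-(3 / 5) : ℝ) +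
          ∑ j ∈ Finset.Icc 1 M, ((a * (x₀ + j) - n : ℕ) : ℝ) ^ (-(3 / 5) : ℝ) := by
        rw [Finset.sum_insert hnot, Finset.sum_image (fun _ _ _ _ h => by simpa using h)]
    _ ≤ 1 + ∑ j ∈ Finset.Icc 1 M, (a : ℝ) ^ (-(3 / 5) : ℝ) * (j : ℝ) ^ (-(3 / 5) : ℝ) := by
        refine add_le_add ?_ (Finset.sum_le_sum fun j hj => ?_)
        · refine Real.rpow_le_one_of_one_le_of_nonpos ?_ (by norm_num)
          exact_mod_cast (by omega : 1 ≤ a * x₀ - n)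
        · have hj1 := (Finset.mem_Icc.mp hj).1
          rw [← Real.mul_rpow (by positivity) (by positivity)]
          refine Real.rpow_le_rpow_of_nonpos (by positivity) ?_ (by norm_num)
          have : a * j ≤ a * (x₀ + j) - n := by rw [mul_add]; omega
          exact_mod_cast this
    _ ≤ 1 + (a : ℝ) ^ (-(3 / 5) : ℝ) * (5 / 2 * (k * n / a : ℝ) ^ (2 / 5 : ℝ)) := by
        rw [← Finset.mul_sum]
        gcongr
        refine (sum_Icc_rpow_neg_three_fifths_le M).trans ?_
        gcongr
        have := Nat.cast_div_le (α := ℝ) (m := k * n) (n := a)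
        push_cast at this
        exact this
    _ = _ := by
        rw [Real.div_rpow (by positivity) ha0.le, Real.mul_rpow (by positivity) (by positivity)]
        have : (a : ℝ) ^ (-(3 / 5) : ℝ) / (a : ℝ) ^ (2 / 5 : ℝ) = 1 / a := by
          rw [← Real.rpow_sub ha0]; norm_num [Real.rpow_neg_one]
        calc _ = 1 + 5 / 2 * (k : ℝ) ^ (2 / 5 : ℝ) * (n : ℝ) ^ (2 / 5 : ℝ) *
              ((a : ℝ) ^ (-(3 / 5) : ℝ) / (a : ℝ) ^ (2 / 5 : ℝ)) := by ring
          _ = _ := by rw [this]; ring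

/-- The new denominator `n x` has the size of `n ^ 2 / a`; this squaring drives the growth of the
exponents. -/
theorem mul_le_of_mem_firstDenominators {k a n x : ℕ} (ha : 0 < a)
    (hx : x ∈ firstDenominators k a n) : (n * x : ℝ) ≤ k * ((n : ℝ) ^ 2 / a) := by
  have ha0 : (0 : ℝ) < a := by exact_mod_cast ha
  have h : (a * x : ℝ) ≤ k * n := by exact_mod_cast (mem_firstDenominators hx).2
  rw [mul_div_assoc', le_div_iff₀ ha0]
  calc (n * x * a : ℝ) = n * (a * x) := by ring
    _ ≤ n * (k * n) := by gcongr
    _ = _ := by ring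

/-- Four unit fractions. -/
theorem exists_ncard_four_unitFractions_le (ε : ℝ) (hε : 0 < ε) :
    ∃ C : ℝ, 0 < C ∧ ∀ a n : ℕ, 0 < a → 0 < n →
      ((unitFractionSolutions 4 a n).ncard : ℝ) ≤
        C * (n : ℝ) ^ ε * (((n : ℝ) ^ 2 / a) ^ (3 / 5 : ℝ) * (1 + (n : ℝ) ^ (2 / 5 : ℝ) / a)) := by
  obtain ⟨C, hC0, hC⟩ := exists_ncard_three_unitFractions_le (ε / 2) (by positivity)
  set c : ℝ := 5 / 2 * (4 : ℝ) ^ (2 / 5 : ℝ) with hc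
  have hc0 : 0 < c := by positivity
  refine ⟨C * 4 ^ (ε / 2) * 4 ^ (3 / 5 : ℝ) * (1 + c), by positivity, fun a n ha hn => ?_⟩
  have ha1 : (1 : ℝ) ≤ a := by exact_mod_cast ha
  have ha0 : (0 : ℝ) < a := by linarith
  have hn0 : (0 : ℝ) < n := by exact_mod_cast hn
  set A : ℝ := C * 4 ^ (ε / 2) * (n : ℝ) ^ ε * (4 ^ (3 / 5 : ℝ) * ((n : ℝ) ^ 2 / a) ^ (3 / 5 : ℝ))
    with hA
  have hA0 : 0 ≤ A := by positivity
  have hterm : ∀ x ∈ firstDenominators 4 a n,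
      ((unitFractionSolutions 3 (a * x - n) (n * x)).ncard : ℝ) ≤
        A * ((a * x - n : ℕ) : ℝ) ^ (-(3 / 5) : ℝ) := by
    intro x hx
    have hx0 := pos_of_mem_firstDenominators hx
    have hb : 0 < a * x - n := Nat.sub_pos_of_lt (mem_firstDenominators hx).1
    have hb0 : (0 : ℝ) < ((a * x - n : ℕ) : ℝ) := by exact_mod_cast hb
    have hnx := mul_le_of_mem_firstDenominators ha hx
    refine (hC _ _ hb (Nat.mul_pos hn hx0)).trans ?_
    rw [Nat.cast_mul, Real.div_rpow (by positivity) hb0.le, Real.rpow_neg hb0.le,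
      ← div_eq_mul_inv A, mul_div_assoc']
    refine div_le_div_of_nonneg_right ?_ (by positivity)
    have h1 : (n * x : ℝ) ^ (ε / 2) ≤ 4 ^ (ε / 2) * (n : ℝ) ^ ε := by
      calc (n * x : ℝ) ^ (ε / 2) ≤ (4 * (n : ℝ) ^ 2) ^ (ε / 2) := by
            refine Real.rpow_le_rpow (by positivity) (hnx.trans ?_) (by positivity)
            push_cast
            gcongr
            exact div_le_self (by positivity) ha1
        _ = 4 ^ (ε / 2) * (n : ℝ) ^ ε := by
            rw [Real.mul_rpow (by norm_num) (by positivity), ← Real.rpow_natCast (n : ℝ) 2,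
              ← Real.rpow_mul hn0.le]
            congr 2; push_cast; ring
    have h2 : (n * x : ℝ) ^ (3 / 5 : ℝ) ≤ 4 ^ (3 / 5 : ℝ) * ((n : ℝ) ^ 2 / a) ^ (3 / 5 : ℝ) := by
      rw [← Real.mul_rpow (by norm_num) (by positivity)]
      exact Real.rpow_le_rpow (by positivity) (by exact_mod_cast hnx) (by norm_num)
    calc C * (n * x : ℝ) ^ (ε / 2) * (n * x : ℝ) ^ (3 / 5 : ℝ)
        ≤ C * (4 ^ (ε / 2) * (n : ℝ) ^ ε) * (4 ^ (3 / 5 : ℝ) * ((n : ℝ) ^ 2 / a) ^ (3 / 5 : ℝ)) := by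
          gcongr
      _ = A := by rw [hA]; ring
  calc ((unitFractionSolutions 4 a n).ncard : ℝ)
      ≤ ∑ x ∈ firstDenominators 4 a n,
          ((unitFractionSolutions 3 (a * x - n) (n * x)).ncard : ℝ) := by
        exact_mod_cast ncard_unitFractionSolutions_succ_le (k := 3) (by norm_num) ha hn
    _ ≤ ∑ x ∈ firstDenominators 4 a n, A * ((a * x - n : ℕ) : ℝ) ^ (-(3 / 5) : ℝ) :=
        Finset.sum_le_sum hterm
    _ ≤ A * (1 + c * ((n : ℝ) ^ (2 / 5 : ℝ) / a)) := by
        rw [← Finset.mul_sum]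
        refine mul_le_mul_of_nonneg_left ?_ hA0
        simpa using sum_firstDenominators_rpow_le (k := 4) (n := n) ha
    _ ≤ A * ((1 + c) * (1 + (n : ℝ) ^ (2 / 5 : ℝ) / a)) := by
        refine mul_le_mul_of_nonneg_left ?_ hA0
        have : 0 ≤ (n : ℝ) ^ (2 / 5 : ℝ) / a := by positivity
        nlinarith
    _ = _ := by rw [hA]; ring

/-- Five unit fractions. The exponent `28/17` leaves room to absorb all factors `n ^ ε`. -/
theorem exists_ncard_five_unitFractions_le :
    ∃ C : ℝ, 0 < C ∧ ∀ a n : ℕ, 0 < a → 0 < n →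
      ((unitFractionSolutions 5 a n).ncard : ℝ) ≤ C * ((n : ℝ) ^ 2 / a) ^ (28 / 17 : ℝ) := by
  classical
  -- `4 / 85 = 28 / 17 - 8 / 5`, the gap between the stated exponent and the one the argument
  -- produces.
  obtain ⟨C, hC0, hC⟩ := exists_ncard_four_unitFractions_le (4 / 85) (by norm_num)
  obtain ⟨Z, hZ0, hZ⟩ := exists_sum_rpow_neg_le (8 / 5) (by norm_num)
  set c : ℝ := 5 / 2 * (5 : ℝ) ^ (2 / 5 : ℝ) with hc
  have hc0 : 0 < c := by positivity
  refine ⟨C * (c + Z) * 5 ^ (28 / 17 : ℝ), by positivity, fun a n ha hn => ?_⟩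
  have ha0 : (0 : ℝ) < a := by exact_mod_cast ha
  have hn0 : (0 : ℝ) < n := by exact_mod_cast hn
  have hle : ((unitFractionSolutions 5 a n).ncard : ℝ) ≤ ∑ x ∈ firstDenominators 5 a n,
      ((unitFractionSolutions 4 (a * x - n) (n * x)).ncard : ℝ) := by
    exact_mod_cast ncard_unitFractionSolutions_succ_le (k := 4) (by norm_num) ha hn
  obtain h0 | ⟨x₁, hx₁⟩ := (firstDenominators 5 a n).eq_empty_or_nonempty
  · rw [h0, Finset.sum_empty] at hle
    exact hle.trans (by positivity)
  set Y : ℝ := 5 * ((n : ℝ) ^ 2 / a) with hY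
  have hY0 : 0 < Y := by positivity
  -- Nonemptiness forces `a ≤ 5 * n`, so powers of `n` can be replaced by powers of `Y`.
  have hYn : (n : ℝ) ≤ Y := by
    have h1 : a ≤ 5 * n := (Nat.le_mul_of_pos_right a (pos_of_mem_firstDenominators hx₁)).trans
      (mem_firstDenominators hx₁).2
    have h2 : (a : ℝ) ≤ 5 * n := by exact_mod_cast h1
    rw [hY, mul_div_assoc', le_div_iff₀ ha0]
    nlinarith
  have hterm : ∀ x ∈ firstDenominators 5 a n,
      ((unitFractionSolutions 4 (a * x - n) (n * x)).ncard : ℝ) ≤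
        C * Y ^ (4 / 85 + 6 / 5 : ℝ) * (((a * x - n : ℕ) : ℝ) ^ (-(3 / 5) : ℝ) +
          Y ^ (2 / 5 : ℝ) * ((a * x - n : ℕ) : ℝ) ^ (-(8 / 5) : ℝ)) := by
    intro x hx
    have hx0 := pos_of_mem_firstDenominators hx
    have hxr : (0 : ℝ) < x := by exact_mod_cast hx0
    have hb : 0 < a * x - n := Nat.sub_pos_of_lt (mem_firstDenominators hx).1
    set b : ℝ := ((a * x - n : ℕ) : ℝ) with hbdef
    have hb0 : 0 < b := by rw [hbdef]; exact_mod_cast hb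
    have hnx : (n * x : ℝ) ≤ Y := by
      have := mul_le_of_mem_firstDenominators ha hx
      push_cast at this
      exact this
    refine (hC _ _ hb (Nat.mul_pos hn hx0)).trans ?_
    rw [Nat.cast_mul, ← hbdef]
    calc C * (n * x : ℝ) ^ (4 / 85 : ℝ) *
          (((n * x : ℝ) ^ 2 / b) ^ (3 / 5 : ℝ) * (1 + (n * x : ℝ) ^ (2 / 5 : ℝ) / b))
        ≤ C * Y ^ (4 / 85 : ℝ) * ((Y ^ 2 / b) ^ (3 / 5 : ℝ) * (1 + Y ^ (2 / 5 : ℝ) / b)) := by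
          gcongr
      _ = C * Y ^ (4 / 85 + 6 / 5 : ℝ) * (b ^ (-(3 / 5) : ℝ) +
            Y ^ (2 / 5 : ℝ) * b ^ (-(8 / 5) : ℝ)) := by
          have h1 : (Y ^ 2 / b) ^ (3 / 5 : ℝ) = Y ^ (6 / 5 : ℝ) * b ^ (-(3 / 5) : ℝ) := by
            rw [Real.div_rpow (by positivity) hb0.le, Real.rpow_neg hb0.le, ← Real.rpow_natCast Y 2,
              ← Real.rpow_mul hY0.le, div_eq_mul_inv]
            norm_num
          have h2 : b ^ (-(8 / 5) : ℝ) = b ^ (-(3 / 5) : ℝ) / b := by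
            rw [show (-(8 / 5) : ℝ) = -(3 / 5) - 1 by norm_num, Real.rpow_sub_one hb0.ne']
          rw [h1, h2, Real.rpow_add hY0]
          ring
  have hsum1 : ∑ x ∈ firstDenominators 5 a n, ((a * x - n : ℕ) : ℝ) ^ (-(3 / 5) : ℝ) ≤
      c * Y ^ (2 / 5 : ℝ) := by
    rw [← Finset.sum_image (f := fun b : ℕ => (b : ℝ) ^ (-(3 / 5) : ℝ))
      (sub_injOn_firstDenominators ha)]
    calc _ ≤ ∑ b ∈ Finset.Icc 1 (5 * n), (b : ℝ) ^ (-(3 / 5) : ℝ) := by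
          refine Finset.sum_le_sum_of_subset_of_nonneg (fun b hb => ?_) fun _ _ _ => by positivity
          obtain ⟨x, hx, rfl⟩ := Finset.mem_image.mp hb
          have := mem_firstDenominators hx
          exact Finset.mem_Icc.mpr ⟨by omega, by omega⟩
      _ ≤ 5 / 2 * ((5 * n : ℕ) : ℝ) ^ (2 / 5 : ℝ) := sum_Icc_rpow_neg_three_fifths_le _
      _ = c * (n : ℝ) ^ (2 / 5 : ℝ) := by
          push_cast
          rw [Real.mul_rpow (by norm_num) hn0.le, hc]; ring
      _ ≤ c * Y ^ (2 / 5 : ℝ) := by gcongr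
  have hsum2 : ∑ x ∈ firstDenominators 5 a n, ((a * x - n : ℕ) : ℝ) ^ (-(8 / 5) : ℝ) ≤ Z := by
    rw [← Finset.sum_image (f := fun b : ℕ => (b : ℝ) ^ (-(8 / 5) : ℝ))
      (sub_injOn_firstDenominators ha)]
    exact hZ _
  calc ((unitFractionSolutions 5 a n).ncard : ℝ) ≤ _ := hle
    _ ≤ _ := Finset.sum_le_sum hterm
    _ ≤ C * Y ^ (4 / 85 + 6 / 5 : ℝ) * (c * Y ^ (2 / 5 : ℝ) + Y ^ (2 / 5 : ℝ) * Z) := by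
        rw [← Finset.mul_sum, Finset.sum_add_distrib, ← Finset.mul_sum]
        gcongr
    _ = C * (c + Z) * Y ^ (28 / 17 : ℝ) := by
        rw [show (28 / 17 : ℝ) = 4 / 85 + 6 / 5 + 2 / 5 by norm_num, Real.rpow_add hY0 _ (2 / 5)]
        ring
    _ = _ := by
        rw [hY, Real.mul_rpow (by norm_num) (by positivity)]; ring

/-! ### Doubling of the exponent with a uniform constant -/

/-- The passage from `k` to `k + 1` unit fractions doubles the exponent. -/
theorem ncard_unitFractionSolutions_succ_le_rpow {k : ℕ} (hk : 0 < k) {E C Z : ℝ}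
    (hE : 28 / 17 ≤ E) (hC : 0 < C)
    (hZ : ∀ B : Finset ℕ, ∑ b ∈ B, (b : ℝ) ^ (-(28 / 17) : ℝ) ≤ Z)
    (h : ∀ a n : ℕ, 0 < a → 0 < n → ((unitFractionSolutions k a n).ncard : ℝ) ≤
      C * ((k : ℝ) ^ (4 / 3 : ℝ) * n ^ 2 / a) ^ E)
    {a n : ℕ} (ha : 0 < a) (hn : 0 < n) :
    ((unitFractionSolutions (k + 1) a n).ncard : ℝ) ≤
      C * (Z * (4 / ((k + 1 : ℕ) : ℝ) ^ (4 / 3 : ℝ)) ^ E +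
        (k + 1 : ℕ) * (4 / ((k + 1 : ℕ) : ℝ) ^ (1 / 3 : ℝ)) ^ E) *
        (((k + 1 : ℕ) : ℝ) ^ (4 / 3 : ℝ) * n ^ 2 / a) ^ (2 * E) := by
  classical
  set K : ℕ := k + 1 with hKdef
  have hE0 : 0 < E := by linarith
  have ha0 : (0 : ℝ) < a := by exact_mod_cast ha
  have hn1 : (1 : ℝ) ≤ n := by exact_mod_cast hn
  have hn0 : (0 : ℝ) < n := by linarith
  have hK0 : (0 : ℝ) < K := by positivity
  set M : ℝ := ((K : ℝ) ^ (4 / 3 : ℝ) * n ^ 2 / a) ^ (2 * E) with hM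
  set U : ℝ := (4 / (K : ℝ) ^ (4 / 3 : ℝ)) ^ E with hU
  set V : ℝ := (4 / (K : ℝ) ^ (1 / 3 : ℝ)) ^ E with hV
  have hU0 : 0 ≤ U := by positivity
  have hV0 : 0 ≤ V := by positivity
  have hM0 : 0 ≤ M := by positivity
  have hterm : ∀ x ∈ firstDenominators K a n,
      ((unitFractionSolutions k (a * x - n) (n * x)).ncard : ℝ) ≤
        C * M * (U * ((a * x - n : ℕ) : ℝ) ^ (-(28 / 17) : ℝ) + V / n) := by
    intro x hx
    have hx0 := pos_of_mem_firstDenominators hx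
    obtain ⟨hx1, hx2⟩ := mem_firstDenominators hx
    have hb : 0 < a * x - n := Nat.sub_pos_of_lt hx1
    refine (h _ _ hb (Nat.mul_pos hn hx0)).trans ?_
    have hbx : ((a * x - n : ℕ) : ℝ) = a * x - n := by
      rw [Nat.cast_sub hx1.le]; push_cast; ring
    have hb1 : (1 : ℝ) ≤ ((a * x - n : ℕ) : ℝ) := by exact_mod_cast hb
    have hbK : ((a * x - n : ℕ) : ℝ) ≤ K * n := by
      exact_mod_cast (Nat.sub_le _ _).trans hx2
    set b : ℝ := ((a * x - n : ℕ) : ℝ)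
    have hb0 : 0 < b := by linarith
    have hax : (a * x : ℝ) = b + n := by linarith
    -- Substituting `a x = b + n` isolates the square of the target quantity. The remaining factor
    -- is of order `1 / b` for `b ≤ n`, summable as `E > 1`, and at most of order `1 / n` for `b >
    -- n`, where at most `K n` terms occur.
    have hfac : (k : ℝ) ^ (4 / 3 : ℝ) * ((n * x : ℕ) : ℝ) ^ 2 / b ≤
        ((K : ℝ) ^ (4 / 3 : ℝ) * n ^ 2 / a) ^ 2 *
          ((b + n) ^ 2 / ((K : ℝ) ^ (4 / 3 : ℝ) * n ^ 2 * b)) := by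
      calc (k : ℝ) ^ (4 / 3 : ℝ) * ((n * x : ℕ) : ℝ) ^ 2 / b
          ≤ (K : ℝ) ^ (4 / 3 : ℝ) * ((n * x : ℕ) : ℝ) ^ 2 / b := by
            gcongr
            omega
        _ = _ := by
            rw [← hax]; push_cast
            have : (K : ℝ) ^ (4 / 3 : ℝ) ≠ 0 := by positivity
            field_simp
    rw [mul_assoc C M]
    refine mul_le_mul_of_nonneg_left ?_ hC.le
    refine (Real.rpow_le_rpow (by positivity) hfac hE0.le).trans ?_
    rw [Real.mul_rpow (by positivity) (by positivity), ← Real.rpow_natCast _ 2,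
      ← Real.rpow_mul (by positivity), Nat.cast_ofNat, ← hM]
    refine mul_le_mul_of_nonneg_left ?_ hM0
    rcases le_or_gt b n with hbn | hbn
    · calc ((b + n) ^ 2 / ((K : ℝ) ^ (4 / 3 : ℝ) * n ^ 2 * b)) ^ E
          ≤ (4 / (K : ℝ) ^ (4 / 3 : ℝ) * b⁻¹) ^ E := by
            refine Real.rpow_le_rpow (by positivity) ?_ hE0.le
            calc (b + n) ^ 2 / ((K : ℝ) ^ (4 / 3 : ℝ) * n ^ 2 * b)
                ≤ (n + n) ^ 2 / ((K : ℝ) ^ (4 / 3 : ℝ) * n ^ 2 * b) := by gcongr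
              _ = _ := by field_simp; ring
        _ = U * b ^ (-E) := by
            rw [Real.mul_rpow (by positivity) (by positivity), Real.inv_rpow hb0.le,
              Real.rpow_neg hb0.le]
        _ ≤ U * b ^ (-(28 / 17) : ℝ) := by
            gcongr
        _ ≤ _ := by
            have : 0 ≤ V / n := by positivity
            linarith
    · calc ((b + n) ^ 2 / ((K : ℝ) ^ (4 / 3 : ℝ) * n ^ 2 * b)) ^ E
          ≤ (4 / (K : ℝ) ^ (1 / 3 : ℝ) * (n : ℝ)⁻¹) ^ E := by
            refine Real.rpow_le_rpow (by positivity) ?_ hE0.le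
            calc (b + n) ^ 2 / ((K : ℝ) ^ (4 / 3 : ℝ) * n ^ 2 * b)
                ≤ (b + b) ^ 2 / ((K : ℝ) ^ (4 / 3 : ℝ) * n ^ 2 * b) := by gcongr
              _ = 4 * b / ((K : ℝ) ^ (4 / 3 : ℝ) * n ^ 2) := by field_simp; ring
              -- Here `b ≤ K * n` costs one power of `K`; the weight exponent `4 / 3` exceeds `1`
              -- and leaves `K ^ (1 / 3)` in the denominator.
              _ ≤ 4 * (K * n) / ((K : ℝ) ^ (4 / 3 : ℝ) * n ^ 2) := by gcongr
              _ = _ := by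
                  rw [show (4 / 3 : ℝ) = 1 / 3 + 1 by norm_num, Real.rpow_add_one hK0.ne']
                  field_simp
        _ = V * (n : ℝ)⁻¹ ^ E := by
            rw [Real.mul_rpow (by positivity) (by positivity)]
        _ ≤ V * (n : ℝ)⁻¹ ^ (1 : ℝ) := by
            refine mul_le_mul_of_nonneg_left ?_ hV0
            exact Real.rpow_le_rpow_of_exponent_ge (by positivity) (inv_le_one_of_one_le₀ hn1)
              (by linarith)
        _ = V / n := by rw [Real.rpow_one]; rfl
        _ ≤ _ := by
            have : 0 ≤ U * b ^ (-(28 / 17) : ℝ) := by positivity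
            linarith
  have hcard : ((firstDenominators K a n).card : ℝ) ≤ K * n := by
    have hsub : firstDenominators K a n ⊆ Finset.Icc 1 (K * n) := fun x hx => by
      have h1 := pos_of_mem_firstDenominators hx
      exact Finset.mem_Icc.mpr
        ⟨h1, (Nat.le_mul_of_pos_left x ha).trans (mem_firstDenominators hx).2⟩
    have := Finset.card_le_card hsub
    rw [Nat.card_Icc, Nat.add_sub_cancel] at this
    exact_mod_cast this
  have hsum : ∑ x ∈ firstDenominators K a n, ((a * x - n : ℕ) : ℝ) ^ (-(28 / 17) : ℝ) ≤ Z := by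
    rw [← Finset.sum_image (f := fun b : ℕ => (b : ℝ) ^ (-(28 / 17) : ℝ))
      (sub_injOn_firstDenominators ha)]
    exact hZ _
  calc ((unitFractionSolutions K a n).ncard : ℝ)
      ≤ ∑ x ∈ firstDenominators K a n,
          ((unitFractionSolutions k (a * x - n) (n * x)).ncard : ℝ) := by
        exact_mod_cast ncard_unitFractionSolutions_succ_le hk ha hn
    _ ≤ _ := Finset.sum_le_sum hterm
    _ = C * M * (U * ∑ x ∈ firstDenominators K a n, ((a * x - n : ℕ) : ℝ) ^ (-(28 / 17) : ℝ) +
          (firstDenominators K a n).card * (V / n)) := by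
        rw [← Finset.mul_sum, Finset.sum_add_distrib, ← Finset.mul_sum, Finset.sum_const,
          nsmul_eq_mul]
    _ ≤ C * M * (U * Z + K * n * (V / n)) := by gcongr
    _ = C * (Z * U + K * V) * M := by field_simp

/-- The constant of the doubling step is at most one for many unit fractions. -/
theorem doubling_constant_le_one {k : ℕ} {Z E : ℝ} (hk : 1000 ≤ k) (hZ : Z ≤ k)
    (hE : 2 ^ (k - 5) ≤ E) :
    Z * (4 / ((k + 1 : ℕ) : ℝ) ^ (4 / 3 : ℝ)) ^ E +
      (k + 1 : ℕ) * (4 / ((k + 1 : ℕ) : ℝ) ^ (1 / 3 : ℝ)) ^ E ≤ 1 := by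
  have hK : (512 : ℝ) ≤ ((k + 1 : ℕ) : ℝ) := by exact_mod_cast (by omega : 512 ≤ k + 1)
  have hkK : Z ≤ ((k + 1 : ℕ) : ℝ) := by push_cast; linarith
  have hKE : ((k + 1 : ℕ) : ℝ) ≤ E := by
    refine le_trans ?_ hE
    have : k + 1 ≤ 2 ^ (k - 5) := by
      obtain ⟨j, rfl⟩ := Nat.exists_eq_add_of_le (show 9 ≤ k by omega)
      have h1 : j < 2 ^ j := Nat.lt_two_pow_self
      have h2 : 2 ^ (9 + j - 5) = 16 * 2 ^ j := by
        rw [show 9 + j - 5 = 4 + j by omega, pow_add]; norm_num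
      omega
    exact_mod_cast this
  set K : ℕ := k + 1
  have hK0 : (0 : ℝ) < K := by linarith
  have hE0 : 0 ≤ E := hK0.le.trans hKE
  have hroot : (8 : ℝ) ≤ (K : ℝ) ^ (1 / 3 : ℝ) := by
    calc (8 : ℝ) = (512 : ℝ) ^ (1 / 3 : ℝ) := by
          rw [show (512 : ℝ) = 8 ^ (3 : ℝ) by norm_num, ← Real.rpow_mul (by norm_num)]; norm_num
      _ ≤ _ := Real.rpow_le_rpow (by norm_num) hK (by norm_num)
  have hroot' : (8 : ℝ) ≤ (K : ℝ) ^ (4 / 3 : ℝ) :=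
    hroot.trans (Real.rpow_le_rpow_of_exponent_le (by linarith) (by norm_num))
  -- Both bases are at most `1 / 2`, and the exponent `E`, exponential in `k`, exceeds `K`; each
  -- summand of the constant is then at most `1 / 2`.
  have hsmall : ∀ y : ℝ, 8 ≤ y → (4 / y) ^ E ≤ 1 / (2 * K) := by
    intro y hy
    calc (4 / y) ^ E ≤ (1 / 2) ^ E := by
          refine Real.rpow_le_rpow (by positivity) ?_ hE0
          rw [div_le_div_iff₀ (by linarith) (by norm_num)]; linarith
      _ ≤ (1 / 2 : ℝ) ^ ((K : ℕ) : ℝ) :=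
          Real.rpow_le_rpow_of_exponent_ge (by norm_num) (by norm_num) hKE
      _ = 1 / 2 ^ K := by rw [Real.rpow_natCast, one_div_pow]
      _ ≤ 1 / (2 * K) := by
          refine one_div_le_one_div_of_le (by positivity) ?_
          have : K = k + 1 := rfl
          have h1 : k < 2 ^ k := Nat.lt_two_pow_self
          have : 2 * K ≤ 2 ^ K := by rw [this, pow_succ]; omega
          exact_mod_cast this
  calc _ ≤ (K : ℝ) * (1 / (2 * K)) + K * (1 / (2 * K)) := by
        gcongr
        · exact hsmall _ hroot'
        · exact hsmall _ hroot
    _ = 1 := by field_simp; norm_num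

/-- At least five unit fractions, with a constant independent of their number. -/
theorem exists_ncard_unitFractions_le :
    ∃ C : ℝ, 0 < C ∧ ∀ k : ℕ, 5 ≤ k → ∀ a n : ℕ, 0 < a → 0 < n →
      ((unitFractionSolutions k a n).ncard : ℝ) ≤
        C * ((k : ℝ) ^ (4 / 3 : ℝ) * n ^ 2 / a) ^ (28 / 17 * 2 ^ (k - 5) : ℝ) := by
  obtain ⟨Z, hZ0, hZ⟩ := exists_sum_rpow_neg_le (28 / 17) (by norm_num)
  have hexp : ∀ k, 5 ≤ k → (28 / 17 * 2 ^ (k + 1 - 5) : ℝ) = 2 * (28 / 17 * 2 ^ (k - 5)) := by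
    intro k hk
    rw [show k + 1 - 5 = k - 5 + 1 by omega, pow_succ]; ring
  have hexp' : ∀ k : ℕ, (28 / 17 : ℝ) ≤ 28 / 17 * 2 ^ (k - 5) := fun k => by
    have : (1 : ℝ) ≤ 2 ^ (k - 5) := one_le_pow₀ (by norm_num)
    linarith
  have each : ∀ k : ℕ, ∃ C : ℝ, 0 < C ∧ (5 ≤ k → ∀ a n : ℕ, 0 < a → 0 < n →
      ((unitFractionSolutions k a n).ncard : ℝ) ≤
        C * ((k : ℝ) ^ (4 / 3 : ℝ) * n ^ 2 / a) ^ (28 / 17 * 2 ^ (k - 5) : ℝ)) := by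
    intro k
    by_cases hk : 5 ≤ k
    swap
    · exact ⟨1, one_pos, fun h => absurd h hk⟩
    induction k, hk using Nat.le_induction with
    | base =>
      obtain ⟨C, hC0, hC⟩ := exists_ncard_five_unitFractions_le
      refine ⟨C, hC0, fun _ a n ha hn => (hC a n ha hn).trans ?_⟩
      refine mul_le_mul_of_nonneg_left ?_ hC0.le
      have h5 : (1 : ℝ) ≤ ((5 : ℕ) : ℝ) ^ (4 / 3 : ℝ) :=
        Real.one_le_rpow (by norm_num) (by norm_num)
      rw [show (28 / 17 * 2 ^ (5 - 5) : ℝ) = 28 / 17 by norm_num]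
      refine Real.rpow_le_rpow (by positivity) ?_ (by norm_num)
      rw [mul_div_assoc]
      exact le_mul_of_one_le_left (by positivity) h5
    | succ k hk ih =>
      obtain ⟨C, hC0, hC⟩ := ih
      refine ⟨C * (Z * (4 / ((k + 1 : ℕ) : ℝ) ^ (4 / 3 : ℝ)) ^ (28 / 17 * 2 ^ (k - 5) : ℝ) +
        (k + 1 : ℕ) * (4 / ((k + 1 : ℕ) : ℝ) ^ (1 / 3 : ℝ)) ^ (28 / 17 * 2 ^ (k - 5) : ℝ)),
        by positivity, fun _ a n ha hn => ?_⟩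
      rw [hexp k hk]
      exact ncard_unitFractionSolutions_succ_le_rpow (by omega) (hexp' k) hC0 hZ (hC hk) ha hn
  choose c hc0 hc using each
  obtain ⟨k₁, hk₁⟩ := exists_nat_ge Z
  -- Up to `k₀` the constants are merely summed; beyond it the induction keeps the same constant.
  set k₀ := max 1000 k₁ with hk₀
  have hC0 : 0 < ∑ k ∈ Finset.range (k₀ + 1), c k :=
    Finset.sum_pos (fun k _ => hc0 k) ⟨0, by simp⟩
  refine ⟨∑ k ∈ Finset.range (k₀ + 1), c k, hC0, ?_⟩
  set C := ∑ k ∈ Finset.range (k₀ + 1), c k with hC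
  have small : ∀ k, 5 ≤ k → k ≤ k₀ → ∀ a n : ℕ, 0 < a → 0 < n →
      ((unitFractionSolutions k a n).ncard : ℝ) ≤
        C * ((k : ℝ) ^ (4 / 3 : ℝ) * n ^ 2 / a) ^ (28 / 17 * 2 ^ (k - 5) : ℝ) := by
    intro k hk hkk a n ha hn
    refine (hc k hk a n ha hn).trans (mul_le_mul_of_nonneg_right ?_ (by positivity))
    exact Finset.single_le_sum (f := c) (fun j _ => (hc0 j).le)
      (Finset.mem_range.mpr (by omega))
  intro k hk
  rcases le_total k k₀ with hkk | hkk
  · exact small k hk hkk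
  · induction k, hkk using Nat.le_induction with
    | base => exact small k₀ hk le_rfl
    | succ k hkk ih =>
      have hk5 : 5 ≤ k := by omega
      intro a n ha hn
      rw [hexp k hk5]
      refine (ncard_unitFractionSolutions_succ_le_rpow (by omega) (hexp' k) hC0 hZ (ih hk5)
        ha hn).trans ?_
      refine mul_le_mul_of_nonneg_right ?_ (by positivity)
      refine mul_le_of_le_one_right hC0.le (doubling_constant_le_one (by omega) ?_ ?_)
      · exact hk₁.trans (by exact_mod_cast (by omega : k₁ ≤ k))
      · have : (0 : ℝ) < 2 ^ (k - 5) := by positivity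
        linarith

/-! ### From arithmetical structures to unit fractions -/

namespace LooplessMultigraph

/-- The defining equation of an arithmetical structure on `m K_n`, with the row sum completed. -/
theorem mul_add_eq_of_mem_arithmeticalStructures {m n : ℕ} {p : (Fin n → ℕ) × (Fin n → ℕ)}
    (hp : p ∈ (multiComplete m n).arithmeticalStructures) (i : Fin n) :
    p.1 i * (p.2 i + m) = m * ∑ j, p.1 j := by
  have h := hp.2.2.2 i
  have h' : ∑ j ∈ Finset.univ.erase i, p.1 j * (multiComplete m n).edges i j =
      m * ∑ j ∈ Finset.univ.erase i, p.1 j := by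
    rw [Finset.mul_sum]
    refine Finset.sum_congr rfl fun j hj => ?_
    have hij : (multiComplete m n).edges i j = m := if_neg (Finset.ne_of_mem_erase hj).symm
    rw [hij, mul_comm]
  rw [mul_add, h, h', ← Finset.add_sum_erase _ _ (Finset.mem_univ i)]
  ring

/-- `(r, d) ↦ d + m` maps `A_dec(m K_n)` to decompositions of `1 / m` into unit fractions. -/
theorem mapsTo_unitFractionSolutions {m n : ℕ} (hm : 1 ≤ m) (hn : 0 < n) :
    Set.MapsTo (fun p : (Fin n → ℕ) × (Fin n → ℕ) => fun i => p.2 i + m)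
      (multiComplete m n).decArithmeticalStructures (unitFractionSolutions n 1 m) := by
  rintro p ⟨hp, hanti⟩
  have hr : ∀ i, 0 < p.1 i := hp.1
  have key := mul_add_eq_of_mem_arithmeticalStructures hp
  have hS : 0 < ∑ j, p.1 j := Finset.sum_pos (fun i _ => hr i) ⟨⟨0, hn⟩, Finset.mem_univ _⟩
  refine ⟨fun i => Nat.add_pos_right _ hm, fun i j hij => ?_, ?_⟩
  · by_contra hlt
    have h1 : p.1 j * (p.2 j + m) < p.1 i * (p.2 i + m) :=
      Nat.mul_lt_mul_of_le_of_lt (hanti hij) (not_le.mp hlt) (hr i)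
    rw [key i, key j] at h1
    exact lt_irrefl _ h1
  · have hmq : (m : ℚ) ≠ 0 := by positivity
    have hSq : (∑ j, (p.1 j : ℚ)) ≠ 0 := by exact_mod_cast hS.ne'
    have hterm : ∀ i, (1 / ((p.2 i + m : ℕ) : ℚ)) = p.1 i / (m * ∑ j, (p.1 j : ℚ)) := by
      intro i
      have hk : (p.1 i : ℚ) * ((p.2 i + m : ℕ) : ℚ) = m * ∑ j, (p.1 j : ℚ) := by
        exact_mod_cast key i
      have hx : ((p.2 i + m : ℕ) : ℚ) ≠ 0 := by positivity
      have hri : (p.1 i : ℚ) ≠ 0 := by exact_mod_cast (hr i).ne'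
      rw [← hk]
      field_simp
    rw [Finset.sum_congr rfl fun i _ => hterm i, ← Finset.sum_div]
    push_cast
    field_simp

/-- Equal `d` make `r` and `r'` proportional, since both are proportional to the reciprocals of `d_i
+ m`; taking gcds of the cross relation shows that the factor is one. -/
theorem injOn_decArithmeticalStructures {m n : ℕ} (hn : 0 < n) :
    Set.InjOn (fun p : (Fin n → ℕ) × (Fin n → ℕ) => fun i => p.2 i + m)
      (multiComplete m n).decArithmeticalStructures := by
  rintro ⟨r, d⟩ ⟨hp, -⟩ ⟨r', d'⟩ ⟨hp', -⟩ hdd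
  have key := mul_add_eq_of_mem_arithmeticalStructures hp
  have key' := mul_add_eq_of_mem_arithmeticalStructures hp'
  simp only at hdd key key'
  obtain rfl : d = d' := by
    funext i
    have := congrFun hdd i
    omega
  have hr : ∀ i, 0 < r i := hp.1
  have hd : ∀ i, 0 < d i := hp.2.1
  have hcross : ∀ i, (∑ j, r' j) * r i = (∑ j, r j) * r' i := by
    intro i
    have hx : 0 < d i + m := by have := hd i; omega
    refine Nat.eq_of_mul_eq_mul_right hx ?_
    rw [mul_assoc, mul_assoc, key i, key' i]; ring
  have hg : Finset.univ.gcd r = 1 := hp.2.2.1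
  have hg' : Finset.univ.gcd r' = 1 := hp'.2.2.1
  have hSS : ∑ j, r' j = ∑ j, r j := by
    have h := congrArg (fun f : Fin n → ℕ => Finset.univ.gcd f) (funext hcross)
    simpa [Finset.gcd_mul_left, hg, hg'] using h
  have hS : 0 < ∑ j, r j := Finset.sum_pos (fun i _ => hr i) ⟨⟨0, hn⟩, Finset.mem_univ _⟩
  have : r = r' := funext fun i => Nat.eq_of_mul_eq_mul_left hS (hSS ▸ hcross i)
  rw [this]

theorem finite_and_ncard_decArithmeticalStructures_le {m n : ℕ} (hm : 1 ≤ m) (hn : 0 < n) :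
    (multiComplete m n).decArithmeticalStructures.Finite ∧
      (multiComplete m n).decArithmeticalStructures.ncard ≤
        (unitFractionSolutions n 1 m).ncard := by
  have hfin := unitFractionSolutions_finite hn one_pos hm
  exact ⟨hfin.of_injOn (mapsTo_unitFractionSolutions hm hn) (injOn_decArithmeticalStructures hn),
    Set.ncard_le_ncard_of_injOn _ (mapsTo_unitFractionSolutions hm hn)
      (injOn_decArithmeticalStructures hn) hfin⟩

end LooplessMultigraph

theorem mainTheorem6 (ε : ℝ) (hε : 0 < ε) :
    (∃ C : ℝ, ∀ m : ℕ, 1 ≤ m →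
      (LooplessMultigraph.multiComplete m 3).decArithmeticalStructures.Finite ∧
      ((LooplessMultigraph.multiComplete m 3).decArithmeticalStructures.ncard : ℝ) ≤
        C * (m : ℝ) ^ ((3 : ℝ) / 5 + ε)) ∧
    (∃ C : ℝ, ∀ m : ℕ, 1 ≤ m →
      (LooplessMultigraph.multiComplete m 4).decArithmeticalStructures.Finite ∧
      ((LooplessMultigraph.multiComplete m 4).decArithmeticalStructures.ncard : ℝ) ≤
        C * (m : ℝ) ^ ((28 : ℝ) / 17 + ε)) ∧
    (∃ C : ℝ, ∀ n m : ℕ, 5 ≤ n → 1 ≤ m →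
      (LooplessMultigraph.multiComplete m n).decArithmeticalStructures.Finite ∧
      ((LooplessMultigraph.multiComplete m n).decArithmeticalStructures.ncard : ℝ) ≤
        C * ((n : ℝ) * (m : ℝ)) ^ ε *
          ((n : ℝ) ^ ((4 : ℝ) / 3) * (m : ℝ) ^ 2) ^ ((28 : ℝ) / 17 * 2 ^ (n - 5))) := by
  refine ⟨?_, ?_, ?_⟩
  · obtain ⟨C, -, hC⟩ := exists_ncard_three_unitFractions_le ε hε
    refine ⟨C, fun m hm => ?_⟩
    obtain ⟨hfin, hle⟩ :=
      LooplessMultigraph.finite_and_ncard_decArithmeticalStructures_le (n := 3) hm (by norm_num)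
    refine ⟨hfin, (Nat.cast_le.mpr hle).trans ((hC 1 m one_pos hm).trans_eq ?_)⟩
    have hm0 : (0 : ℝ) < m := by exact_mod_cast hm
    rw [Nat.cast_one, div_one, Real.rpow_add hm0]
    ring
  · obtain ⟨C, hC0, hC⟩ := exists_ncard_four_unitFractions_le ε hε
    refine ⟨2 * C, fun m hm => ?_⟩
    obtain ⟨hfin, hle⟩ :=
      LooplessMultigraph.finite_and_ncard_decArithmeticalStructures_le (n := 4) hm (by norm_num)
    refine ⟨hfin, (Nat.cast_le.mpr hle).trans ((hC 1 m one_pos hm).trans ?_)⟩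
    have hm1 : (1 : ℝ) ≤ m := by exact_mod_cast hm
    have hm0 : (0 : ℝ) < m := by linarith
    have h1 : (1 : ℝ) ≤ (m : ℝ) ^ (2 / 5 : ℝ) := Real.one_le_rpow hm1 (by norm_num)
    have h2 : ((m : ℝ) ^ 2) ^ (3 / 5 : ℝ) = (m : ℝ) ^ (6 / 5 : ℝ) := by
      rw [← Real.rpow_natCast, ← Real.rpow_mul hm0.le]; norm_num
    rw [Nat.cast_one, div_one, div_one, h2]
    calc C * (m : ℝ) ^ ε * ((m : ℝ) ^ (6 / 5 : ℝ) * (1 + (m : ℝ) ^ (2 / 5 : ℝ)))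
        ≤ C * (m : ℝ) ^ ε * ((m : ℝ) ^ (6 / 5 : ℝ) *
            ((m : ℝ) ^ (2 / 5 : ℝ) + (m : ℝ) ^ (2 / 5 : ℝ))) := by gcongr
      -- The argument gives `8 / 5 + ε`, which is below `28 / 17 + ε`.
      _ = 2 * C * (m : ℝ) ^ (6 / 5 + 2 / 5 + ε : ℝ) := by
          rw [Real.rpow_add hm0, Real.rpow_add hm0]; ring
      _ ≤ 2 * C * (m : ℝ) ^ ((28 : ℝ) / 17 + ε) := by
          gcongr
          norm_num
  · obtain ⟨C, hC0, hC⟩ := exists_ncard_unitFractions_le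
    refine ⟨C, fun n m hn hm => ?_⟩
    obtain ⟨hfin, hle⟩ :=
      LooplessMultigraph.finite_and_ncard_decArithmeticalStructures_le (n := n) hm (by omega)
    refine ⟨hfin, (Nat.cast_le.mpr hle).trans ((hC n hn 1 m one_pos hm).trans ?_)⟩
    rw [Nat.cast_one, div_one]
    refine mul_le_mul_of_nonneg_right ?_ (by positivity)
    -- The factor `(n m) ^ ε` is at least one and is not needed for the bound.
    refine le_mul_of_one_le_right hC0.le (Real.one_le_rpow ?_ hε.le)
    exact_mod_cast Nat.mul_pos (by omega : 0 < n) hm
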